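/- For $n\ge 0$ let $$\mathfrak L_n(x_1,\dots,x_n)=\sum_{0<k_1<\dots<k_n}\frac{x_1^{k_1}\cdots x_n^{k_n}}{k_1\cdots k_n}\qquad(|x_i|<1)$$ be the multiple logarithm. For $1\le i\le j\le n$ put $\mathcal D_{ij}=\{x\in\mathbb C^n: x_i\cdots x_j=1\}$, let $X_n=\bigcup_{i\le j}\mathcal D_{ij}$ and $S_n=\mathbb C^n\setminus X_n$. Fix a base point $b$ in the open unit polydisc $\{|x_i|<1\}\subset S_n$ (for instance $b=0$). For a loop $q:[0,1]\to S_n$ based at $b$, say that $q$ *encloses* $\mathcal D_{ij}$ if the disc $\{r\,q(t): 0\le r\le 1,\ 0\le t\le 1\}$ spanned by $q$ over the origin meets $\mathcal D_{ij}$. Say that $q$ is a *loop around $\mathcal D_{ij}$*, $m$ times ($m\in\mathbb Z$), if the winding number of $x_i\cdots x_j$ about $1$ along $q$ is $m$ (a continuous branch of $\log(1-x_i\cdots x_j)$ along $q$ increases by $2\pi i\,m$) and $q$ encloses no component of $X_n$ other than $\mathcal D_{ij}$. The loop $q$ has *trivial monodromy* on $\mathfrak L_n$ if, for every path $p$ in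 $\mathbb C^n$ starting at $b$ and every germ $g$ at the end point of $p$, the germ of $\mathfrak L_n$ at $b$ continues analytically to $g$ along $q$ followed by $p$ if and only if it continues analytically to $g$ along $p$. Then: 1. every loop around $\mathcal D_{ii}=\{x_i=1\}$, $1\le i<n$, any number of times, has trivial monodromy on $\mathfrak L_n$; 2. every loop around $\mathcal D_{ij}=\{x_i\cdots x_j=1\}$, $1\le i<j<n$, any number of times, has trivial monodromy on $\mathfrak L_n$; 3. the only nontrivial monodromy is around the components $\mathcal D_{sn}=\{x_s\cdots x_n=1\}$: a loop in $S_n$ based at $b$ whose monodromy on $\mathfrak L_n$ is not trivial encloses $\mathcal D_{sn}$ for some $1\le s\le n$; and for every $1\le s\le n$ and $m\ne 0$, no loop that goes $m$ times around $\mathcal D_{sn}$ has trivial monodromy on $\mathfrak L_n$. -/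

import Mathlib

open Filter Topology

namespace MultiLog

/-- The strictly increasing tuples `0 < k_1 < ⋯ < k_n` of positive integers. -/
def IncTuple (n : ℕ) : Type :=
  {k : Fin n → ℕ // StrictMono k ∧ ∀ i, 0 < k i}

/-- The power series `Li_{1,…,1}(x) = ∑_{0 < k_1 < ⋯ < k_n} ∏ x_i ^ k_i / k_i`. It converges
absolutely on the open unit polydisc, and only its values there are used: they are the principal
branch of the multiple logarithm. -/
noncomputable def multiLog (n : ℕ) (x : Fin n → ℂ) : ℂ :=
  ∑' k : IncTuple n, ∏ i, x i ^ k.1 i / (k.1 i : ℂ)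

/-- The consecutive product `x_i ⋯ x_j`. -/
def consecProd {n : ℕ} (i j : Fin n) (x : Fin n → ℂ) : ℂ :=
  ∏ k ∈ Finset.Icc i j, x k

/-- The divisor `D_{ij} = {x_i ⋯ x_j = 1}` (used for `i ≤ j`). -/
def divisor {n : ℕ} (i j : Fin n) : Set (Fin n → ℂ) :=
  {x | consecProd i j x = 1}

/-- `S_n`, the complement of the union `X_n` of all divisors `D_{ij}`, `i ≤ j`. -/
def regularLocus (n : ℕ) : Set (Fin n → ℂ) :=
  {x | ∀ i j : Fin n, i ≤ j → x ∉ divisor i j}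

/-- Analytic continuation of germs along a path `γ` from `a` to `x` in `ℂⁿ`: there are functions
`F t`, analytic at `γ t`, such that for `s` near `t` the germs of `F s` and `F t` at `γ s` agree,
and such that `F 0` has the germ of `f` at `a` and `F 1` has the germ of `g` at `x`. -/
def ContinuesTo {n : ℕ} {a x : Fin n → ℂ} (γ : Path a x) (f g : (Fin n → ℂ) → ℂ) : Prop :=
  ∃ F : unitInterval → (Fin n → ℂ) → ℂ,
    (∀ t, AnalyticAt ℂ (F t) (γ t)) ∧
    (∀ t, ∀ᶠ s in 𝓝 t, F s =ᶠ[𝓝 (γ s)] F t) ∧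
    F 0 =ᶠ[𝓝 a] f ∧ F 1 =ᶠ[𝓝 x] g

/-- The loop `q` acts trivially on (the principal branch at `b` of) the multiple logarithm:
for every path `p` that starts at `b`, continuation along `q` followed by `p` gives the same
result as continuation along `p`. -/
def TrivialMonodromy {n : ℕ} {b : Fin n → ℂ} (q : Path b b) : Prop :=
  ∀ (x : Fin n → ℂ) (p : Path b x) (g : (Fin n → ℂ) → ℂ),
    ContinuesTo (q.trans p) (multiLog n) g ↔ ContinuesTo p (multiLog n) g

/-- The disc `{r q(t) : 0 ≤ r ≤ 1}` that the loop `q` spans over the origin. -/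
def spannedDisc {n : ℕ} {b : Fin n → ℂ} (q : Path b b) : Set (Fin n → ℂ) :=
  {y | ∃ r : ℝ, 0 ≤ r ∧ r ≤ 1 ∧ ∃ t, y = (r : ℂ) • q t}

/-- `q` encloses the divisor `D_{ij}`: the disc spanned by `q` meets it. -/
def Encloses {n : ℕ} {b : Fin n → ℂ} (q : Path b b) (i j : Fin n) : Prop :=
  (spannedDisc q ∩ divisor i j).Nonempty

/-- The winding number of `x_i ⋯ x_j` around `1` along `q` is `m`, i.e. a continuous branch of
`log (1 - x_i ⋯ x_j)` along `q` increases by `2 π i m`. -/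
def WindsAround {n : ℕ} {b : Fin n → ℂ} (q : Path b b) (i j : Fin n) (m : ℤ) : Prop :=
  ∃ l : unitInterval → ℂ, Continuous l ∧ (∀ t, Complex.exp (l t) = 1 - consecProd i j (q t)) ∧
    l 1 - l 0 = 2 * (Real.pi : ℂ) * Complex.I * (m : ℂ)

/-- `q` is a loop in `S_n` that goes `m` times around `D_{ij}` and encloses no other irreducible
component of `X_n`. -/
structure IsLoopAround {n : ℕ} {b : Fin n → ℂ} (q : Path b b) (i j : Fin n) (m : ℤ) : Prop where
  mem_regularLocus : ∀ t, q t ∈ regularLocus n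
  winds : WindsAround q i j m
  not_encloses : ∀ k l : Fin n, k ≤ l → (k, l) ≠ (i, j) → ¬ Encloses q k l

end MultiLog

namespace MultiLog

/-! The multiple logarithm is an iterated integral along straight rays: with `y = x_s ⋯ x_n`, the
function of depth `s` in the variables `x_1, …, x_{s-1}, y` is `∫₀¹ L_{s-1}(x_1, …, x_{s-2}, x_{s-1}
v y) · y / (1 - v y) dv`. The nested integrand is singular only where a ray from `0` to some `x_i ⋯
x_n` hits `1`. A loop enclosing no `D_{in}` therefore stays where the integral itself is analytic,
and the principal branch returns unchanged (`trivialMonodromy_of_not_encloses`). This gives the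
triviality around every divisor not involving the last variable.

For nontriviality, suppose a loop around `D_{sn}` fixes the principal branch. Continuation commutes
with differential operators, and the Euler field of the last variable, applied to the function of
one depth, yields `y / (1 - y)` times the function of the depth below. Multiplying by the `weight`
monomials removes the division by `y`, which may vanish at `b`. Descending with
`lowerDepth_weight_mul`, the weighted function of depth `s` is also fixed
(`continuesTo_weight_mul`). In that depth the singularity is explicit (`depthLog_succ_eq`):
splitting `L_{s-1}` at the upper value `v y` into its value at `1` plus `(v y - 1)` times a divided
difference gives `-L_{s-1}(x_1, …, x_{s-1}) log(1 - y)` plus a part analytic along the loop. The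
logarithm gains `2πi m`, so `m` times a nonzero analytic function would vanish near `b`.

Analyticity of the integrals is obtained by regarding them as values in the Banach algebra of
continuous functions on a square, where multiplication, inversion and integration are analytic. -/

/-! ### Germs and analytic continuation along paths. -/

/-- Near a point where `f` and `g` are analytic, their germs agree at one point if and only if they
agree at the centre. -/
theorem eventually_germ_eq_iff {n : ℕ} {a : Fin n → ℂ} {f g : (Fin n → ℂ) → ℂ}
    (hf : AnalyticAt ℂ f a) (hg : AnalyticAt ℂ g a) :
    ∀ᶠ y in 𝓝 a, (f =ᶠ[𝓝 y] g ↔ f =ᶠ[𝓝 a] g) := by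
  obtain ⟨r, hr, hball⟩ := Metric.eventually_nhds_iff_ball.1
    (hf.eventually_analyticAt.and hg.eventually_analyticAt)
  filter_upwards [Metric.ball_mem_nhds a hr] with y hy
  have key : ∀ u ∈ Metric.ball a r, ∀ v ∈ Metric.ball a r, f =ᶠ[𝓝 u] g → f =ᶠ[𝓝 v] g := by
    intro u hu v hv huv
    have := AnalyticOnNhd.eqOn_of_preconnected_of_eventuallyEq (fun z hz => (hball z hz).1)
      (fun z hz => (hball z hz).2) (convex_ball a r).isPreconnected hu huv
    exact this.eventuallyEq_of_mem (Metric.isOpen_ball.mem_nhds hv)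
  exact ⟨key y hy a (Metric.mem_ball_self hr), key a (Metric.mem_ball_self hr) y hy⟩

/-- Analytic continuation along a path is unique. -/
theorem ContinuesTo.unique {n : ℕ} {a x : Fin n → ℂ} {γ : Path a x}
    {f f' g g' : (Fin n → ℂ) → ℂ} (h : ContinuesTo γ f g) (h' : ContinuesTo γ f' g')
    (hff' : f =ᶠ[𝓝 a] f') : g =ᶠ[𝓝 x] g' := by
  obtain ⟨F, hFa, hFl, hF0, hF1⟩ := h
  obtain ⟨F', hFa', hFl', hF0', hF1'⟩ := h'
  have hloc : ∀ t, ∀ᶠ s in 𝓝 t, (F s =ᶠ[𝓝 (γ s)] F' s ↔ F t =ᶠ[𝓝 (γ t)] F' t) := by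
    intro t
    filter_upwards [hFl t, hFl' t,
      γ.continuous.continuousAt.eventually (eventually_germ_eq_iff (hFa t) (hFa' t))]
      with s h1 h2 h3
    rw [← h3]
    exact ⟨fun h => h1.symm.trans (h.trans h2), fun h => h1.trans (h.trans h2.symm)⟩
  have hclopen : IsClopen {t | F t =ᶠ[𝓝 (γ t)] F' t} := by
    constructor
    · rw [← isOpen_compl_iff, isOpen_iff_mem_nhds]
      intro t ht
      filter_upwards [hloc t] with s hs
      exact fun h => ht (hs.1 h)
    · rw [isOpen_iff_mem_nhds]
      intro t ht
      filter_upwards [hloc t] with s hs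
      exact hs.2 ht
  have h0 : F 0 =ᶠ[𝓝 (γ 0)] F' 0 := by
    rw [γ.source]
    exact hF0.trans (hff'.trans hF0'.symm)
  have h1 : (1 : unitInterval) ∈ {t | F t =ᶠ[𝓝 (γ t)] F' t} := by
    rw [hclopen.eq_univ ⟨0, h0⟩]
    trivial
  have h1' : F 1 =ᶠ[𝓝 x] F' 1 := by simpa using h1
  exact hF1.symm.trans (h1'.trans hF1')

theorem ContinuesTo.congr {n : ℕ} {a x : Fin n → ℂ} {γ : Path a x}
    {f f' g g' : (Fin n → ℂ) → ℂ} (h : ContinuesTo γ f g)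
    (hf : f =ᶠ[𝓝 a] f') (hg : g =ᶠ[𝓝 x] g') : ContinuesTo γ f' g' := by
  obtain ⟨F, hFa, hFl, hF0, hF1⟩ := h
  exact ⟨F, hFa, hFl, hF0.trans hf, hF1.trans hg⟩

/-- A function that is analytic along a path continues to itself. -/
theorem continuesTo_self {n : ℕ} {a x : Fin n → ℂ} (γ : Path a x) {f : (Fin n → ℂ) → ℂ}
    (h : ∀ t, AnalyticAt ℂ f (γ t)) : ContinuesTo γ f f :=
  ⟨fun _ => f, h, fun _ => Eventually.of_forall fun _ => EventuallyEq.rfl,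
    EventuallyEq.rfl, EventuallyEq.rfl⟩

/-- A local operator that preserves analyticity along a path commutes with continuation. -/
theorem ContinuesTo.map {n : ℕ} {a x : Fin n → ℂ} {γ : Path a x} {f g : (Fin n → ℂ) → ℂ}
    (h : ContinuesTo γ f g) (op : ((Fin n → ℂ) → ℂ) → (Fin n → ℂ) → ℂ)
    (hop : ∀ y φ, AnalyticAt ℂ φ y → AnalyticAt ℂ (op φ) y)
    (hloc : ∀ y φ ψ, φ =ᶠ[𝓝 y] ψ → op φ =ᶠ[𝓝 y] op ψ) : ContinuesTo γ (op f) (op g) := by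
  obtain ⟨F, hFa, hFl, hF0, hF1⟩ := h
  exact ⟨fun t => op (F t), fun t => hop _ _ (hFa t), fun t => (hFl t).mono fun s hs => hloc _ _ _ hs,
    hloc _ _ _ hF0, hloc _ _ _ hF1⟩

/-- Continuation along a concatenation is continuation along the first path, then the second. -/
theorem continuesTo_trans_iff {n : ℕ} {a b x : Fin n → ℂ} (q : Path a b) (p : Path b x)
    {f g : (Fin n → ℂ) → ℂ} :
    ContinuesTo (q.trans p) f g ↔ ∃ h, ContinuesTo q f h ∧ ContinuesTo p h g := by
  constructor
  · rintro ⟨F, hFa, hFl, hF0, hF1⟩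
    let σ₁ : unitInterval → unitInterval := fun t => ⟨t / 2, by
      have := t.2.1; have := t.2.2; constructor <;> linarith⟩
    let σ₂ : unitInterval → unitInterval := fun t => ⟨(t + 1) / 2, by
      have := t.2.1; have := t.2.2; constructor <;> linarith⟩
    have hσ₁ : Continuous σ₁ := by fun_prop
    have hσ₂ : Continuous σ₂ := by fun_prop
    have e₁ : ∀ t, (q.trans p) (σ₁ t) = q t := by
      intro t
      have h2 : ((σ₁ t : unitInterval) : ℝ) ≤ 1 / 2 := by
        have := t.2.2
        show (t : ℝ) / 2 ≤ 1 / 2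
        linarith
      rw [Path.trans_apply, dif_pos h2]
      congr 1
      ext
      show 2 * ((t : ℝ) / 2) = t
      ring
    have e₂ : ∀ t, (q.trans p) (σ₂ t) = p t := by
      intro t
      rw [Path.trans_apply]
      split_ifs with h2
      · have h3 : (t : ℝ) = 0 := by
          have := t.2.1
          have h4 : ((t : ℝ) + 1) / 2 ≤ 1 / 2 := h2
          linarith
        have h3' : t = 0 := by ext; exact h3
        subst h3'
        have : (⟨2 * ((σ₂ 0 : unitInterval) : ℝ), (unitInterval.mul_pos_mem_iff zero_lt_two).2
            ⟨(σ₂ 0).2.1, h2⟩⟩ : unitInterval) = 1 := by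
          ext
          show 2 * (((0 : ℝ) + 1) / 2) = 1
          ring
        rw [this]
        simp
      · congr 1
        ext
        show 2 * (((t : ℝ) + 1) / 2) - 1 = t
        ring
    have hmid : σ₁ 1 = σ₂ 0 := by
      ext
      show (1 : ℝ) / 2 = (0 + 1) / 2
      ring
    have hσ₁0 : σ₁ 0 = 0 := by
      ext
      show (0 : ℝ) / 2 = 0
      ring
    have hσ₂1 : σ₂ 1 = 1 := by
      ext
      show ((1 : ℝ) + 1) / 2 = 1
      ring
    refine ⟨F (σ₁ 1), ⟨fun t => F (σ₁ t), fun t => ?_, fun t => ?_, ?_, EventuallyEq.rfl⟩,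
      ⟨fun t => F (σ₂ t), fun t => ?_, fun t => ?_, ?_, ?_⟩⟩
    · rw [← e₁]; exact hFa _
    · filter_upwards [hσ₁.continuousAt.eventually (hFl (σ₁ t))] with s hs
      rwa [← e₁]
    · show F (σ₁ 0) =ᶠ[𝓝 a] f
      rw [hσ₁0]; exact hF0
    · rw [← e₂]; exact hFa _
    · filter_upwards [hσ₂.continuousAt.eventually (hFl (σ₂ t))] with s hs
      rwa [← e₂]
    · rw [hmid]
    · show F (σ₂ 1) =ᶠ[𝓝 x] g
      rw [hσ₂1]; exact hF1
  · rintro ⟨h, ⟨F, hFa, hFl, hF0, hF1⟩, ⟨G, hGa, hGl, hG0, hG1⟩⟩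
    let c₁ : unitInterval → unitInterval := fun t => Set.projIcc 0 1 zero_le_one (2 * (t : ℝ))
    let c₂ : unitInterval → unitInterval := fun t => Set.projIcc 0 1 zero_le_one (2 * (t : ℝ) - 1)
    have hc₁ : Continuous c₁ := by
      show Continuous fun t : unitInterval => Set.projIcc (0 : ℝ) 1 zero_le_one (2 * (t : ℝ))
      exact continuous_projIcc.comp (by fun_prop)
    have hc₂ : Continuous c₂ := by
      show Continuous fun t : unitInterval => Set.projIcc (0 : ℝ) 1 zero_le_one (2 * (t : ℝ) - 1)
      exact continuous_projIcc.comp (by fun_prop)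
    have e₁ : ∀ t : unitInterval, (t : ℝ) ≤ 1 / 2 → (q.trans p) t = q (c₁ t) := by
      intro t ht
      rw [Path.trans_apply, dif_pos ht]
      congr 1
      exact (Set.projIcc_of_mem zero_le_one _).symm
    have e₂ : ∀ t : unitInterval, 1 / 2 ≤ (t : ℝ) → (q.trans p) t = p (c₂ t) := by
      intro t ht
      rcases ht.eq_or_lt with ht | ht
      · rw [e₁ t ht.ge]
        have h1 : c₁ t = 1 := by
          simp only [c₁, ← ht]
          exact Set.projIcc_of_right_le _ (by norm_num)
        have h2 : c₂ t = 0 := by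
          simp only [c₂, ← ht]
          exact Set.projIcc_of_le_left _ (by norm_num)
        rw [h1, h2]
        simp
      · rw [Path.trans_apply, dif_neg (not_le.2 ht)]
        congr 1
        exact (Set.projIcc_of_mem zero_le_one _).symm
    have hlt : ∀ t : unitInterval, (t : ℝ) < 1 / 2 → ∀ᶠ s : unitInterval in 𝓝 t, (s : ℝ) < 1 / 2 :=
      fun t ht => continuous_subtype_val.continuousAt.eventually (eventually_lt_nhds ht)
    have hgt : ∀ t : unitInterval, 1 / 2 < (t : ℝ) → ∀ᶠ s : unitInterval in 𝓝 t, 1 / 2 < (s : ℝ) :=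
      fun t ht => continuous_subtype_val.continuousAt.eventually (eventually_gt_nhds ht)
    refine ⟨fun t => if (t : ℝ) ≤ 1 / 2 then F (c₁ t) else G (c₂ t), fun t => ?_, fun t => ?_,
      ?_, ?_⟩
    · dsimp only
      split_ifs with ht
      · rw [e₁ t ht]; exact hFa _
      · rw [e₂ t (not_le.1 ht).le]; exact hGa _
    · have l₁ := hc₁.continuousAt.eventually (hFl (c₁ t))
      have l₂ := hc₂.continuousAt.eventually (hGl (c₂ t))
      rcases lt_trichotomy (t : ℝ) (1 / 2) with ht | ht | ht
      · filter_upwards [hlt t ht, l₁] with s hs h1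
        rw [if_pos hs.le, if_pos ht.le, e₁ s hs.le]
        exact h1
      -- At the junction `t = 1 / 2` the two families are glued: `F 1` and `G 0` both have the germ
      -- of `h` at `b`.
      · have h1 : c₁ t = 1 := by
          simp only [c₁, ht]
          exact Set.projIcc_of_right_le _ (by norm_num)
        have h2 : c₂ t = 0 := by
          simp only [c₂, ht]
          exact Set.projIcc_of_le_left _ (by norm_num)
        have hpt : p (c₂ t) = b := by rw [h2]; simp
        have hFG : ∀ᶠ y in 𝓝 (p (c₂ t)), G 0 =ᶠ[𝓝 y] F 1 := by
          rw [hpt]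
          exact (hG0.trans hF1.symm).eventuallyEq_nhds
        filter_upwards [l₁, l₂, (p.continuous.comp hc₂).continuousAt.eventually hFG]
          with s h3 h4 h5
        rw [if_pos ht.le, h1]
        split_ifs with hs
        · rw [e₁ s hs, ← h1]; exact h3
        · rw [e₂ s (not_le.1 hs).le]
          rw [h2] at h4
          exact h4.trans h5
      · filter_upwards [hgt t ht, l₂] with s hs h1
        rw [if_neg (not_le.2 hs), if_neg (not_le.2 ht), e₂ s hs.le]
        exact h1
    · have h1 : c₁ 0 = 0 := Set.projIcc_of_le_left _ (by simp)
      simpa [h1] using hF0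
    · have h2 : c₂ 1 = 1 := Set.projIcc_of_right_le _ (by norm_num)
      have h3 : ¬ ((1 : unitInterval) : ℝ) ≤ 1 / 2 := by norm_num
      dsimp only
      rw [if_neg h3, h2]
      exact hG1

/-- A loop along which the principal branch continues to itself acts trivially. -/
theorem trivialMonodromy_of_continuesTo {n : ℕ} {b : Fin n → ℂ} {q : Path b b}
    (h : ContinuesTo q (multiLog n) (multiLog n)) : TrivialMonodromy q := by
  intro x p g
  rw [continuesTo_trans_iff]
  constructor
  · rintro ⟨f, hf, hg⟩
    exact hg.congr (hf.unique h EventuallyEq.rfl) EventuallyEq.rfl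
  · exact fun hg => ⟨_, h, hg⟩

/-- If the principal branch is analytic at the base point, then along a loop that acts trivially
it continues to itself. -/
theorem TrivialMonodromy.continuesTo {n : ℕ} {b : Fin n → ℂ} {q : Path b b}
    (h : TrivialMonodromy q) (hb : AnalyticAt ℂ (multiLog n) b) :
    ContinuesTo q (multiLog n) (multiLog n) := by
  have hrefl : ContinuesTo (Path.refl b) (multiLog n) (multiLog n) :=
    continuesTo_self _ fun _ => hb
  -- Test triviality on the constant path, with the principal branch itself as target germ.
  obtain ⟨f, hf, hg⟩ := (continuesTo_trans_iff _ _).1 ((h b (Path.refl b) _).2 hrefl)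
  have hfa : AnalyticAt ℂ f b := by
    obtain ⟨F, hFa, -, -, hF1⟩ := hf
    have := hFa 1
    rw [q.target] at this
    exact this.congr hF1
  have hfr : ContinuesTo (Path.refl b) f f := continuesTo_self _ fun _ => hfa
  exact hf.congr EventuallyEq.rfl (hfr.unique hg EventuallyEq.rfl)

/-! ### Iterated integrals with values in a Banach algebra. -/

/-- Continuous functions of `(u, t)` on the unit square. -/
abbrev SquareAlg : Type := C(unitInterval × unitInterval, ℂ)

/-- The first coordinate `u` on the unit square. -/
def fstVar : SquareAlg := ⟨fun z => ((z.1 : ℝ) : ℂ), by fun_prop⟩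

/-- The second coordinate `t` on the unit square. -/
def sndVar : SquareAlg := ⟨fun z => ((z.2 : ℝ) : ℂ), by fun_prop⟩

@[simp] theorem fstVar_apply (z : unitInterval × unitInterval) : fstVar z = ((z.1 : ℝ) : ℂ) := rfl

@[simp] theorem sndVar_apply (z : unitInterval × unitInterval) : sndVar z = ((z.2 : ℝ) : ℂ) := rfl

theorem integrable_of_continuous {f : unitInterval → ℂ} (hf : Continuous f) :
    MeasureTheory.Integrable f :=
  hf.integrable_of_hasCompactSupport (HasCompactSupport.of_compactSpace f)

/-- The mean `(u, t) ↦ ∫₀¹ f (u, t v) dv` over the segment from `(u, 0)` to `(u, t)`. -/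
noncomputable def rayMean : SquareAlg →L[ℂ] SquareAlg :=
  LinearMap.mkContinuous
    { toFun := fun f => ⟨fun z => ∫ v : unitInterval, f (z.1, z.2 * v), by
        have := continuous_parametric_integral_of_continuous
          (μ := (MeasureTheory.volume : MeasureTheory.Measure unitInterval))
          (f := fun (z : unitInterval × unitInterval) (v : unitInterval) => f (z.1, z.2 * v))
          (by simp only [Function.uncurry_def]; fun_prop) (s := Set.univ) isCompact_univ
        simpa using this⟩
      map_add' := fun f g => by
        ext z
        exact MeasureTheory.integral_add (integrable_of_continuous (by fun_prop))
          (integrable_of_continuous (by fun_prop))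
      map_smul' := fun c f => by
        ext z
        exact MeasureTheory.integral_const_mul c _ } 1 fun f => by
    rw [one_mul]
    refine (ContinuousMap.norm_le _ (norm_nonneg f)).2 fun z => ?_
    have := MeasureTheory.norm_integral_le_of_norm_le_const
      (μ := (MeasureTheory.volume : MeasureTheory.Measure unitInterval))
      (f := fun v => f (z.1, z.2 * v)) (C := ‖f‖)
      (Eventually.of_forall fun v => f.norm_coe_le_norm _)
    simpa using this

theorem rayMean_apply (f : SquareAlg) (z : unitInterval × unitInterval) :
    rayMean f z = ∫ v : unitInterval, f (z.1, z.2 * v) := rfl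

theorem isUnit_iff (f : SquareAlg) : IsUnit f ↔ ∀ z, f z ≠ 0 :=
  ContinuousMap.isUnit_iff_forall_ne_zero f

theorem inverse_apply {f : SquareAlg} (hf : IsUnit f) (z : unitInterval × unitInterval) :
    (Ring.inverse f) z = (f z)⁻¹ := by
  have h : (f * Ring.inverse f) z = (1 : SquareAlg) z := by rw [Ring.mul_inverse_cancel f hf]
  exact eq_inv_of_mul_eq_one_right h

/-- The iterated integral `L_n(x_0, …, x_{n-2}, t ρ x_{n-1})` of the multiple logarithm. -/
noncomputable def iter (x : ℕ → ℂ) : ℕ → SquareAlg → SquareAlg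
  | 0, _ => 1
  | n + 1, ρ => sndVar * rayMean
      (iter x n (x n • ρ) * (x n • ρ) * Ring.inverse (1 - sndVar * (x n • ρ)))

/-- The divided difference of `iter x n` at the points `w * ρ` and `ρ`. -/
noncomputable def iterDiff (x : ℕ → ℂ) (w : SquareAlg) : ℕ → SquareAlg → SquareAlg
  | 0, _ => 0
  | n + 1, ρ => sndVar * rayMean
      (iterDiff x w n (x n • ρ) * (w * (x n • ρ)) * Ring.inverse (1 - sndVar * (w * (x n • ρ)))
        + iter x n (x n • ρ) * (x n • ρ) * (Ring.inverse (1 - sndVar * (w * (x n • ρ))) *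
          Ring.inverse (1 - sndVar * (x n • ρ))))

/-- No integration path of `iter x n ρ` meets a singularity of the integrand. -/
def Admissible (x : ℕ → ℂ) (n : ℕ) (ρ : SquareAlg) : Prop :=
  ∀ i < n, ∀ z : unitInterval × unitInterval,
    ((z.2 : ℝ) : ℂ) * ((∏ j ∈ Finset.Ico i n, x j) * ρ z) ≠ 1

theorem Admissible.pred {x : ℕ → ℂ} {n : ℕ} {ρ : SquareAlg} (h : Admissible x (n + 1) ρ) :
    Admissible x n (x n • ρ) := by
  intro i hi z
  have := h i (by omega) z
  rw [Finset.prod_Ico_succ_top hi.le] at this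
  simpa [mul_assoc] using this

/-- A factor in `[0, 1]` only shortens the rays. -/
theorem Admissible.smul {x : ℕ → ℂ} {n : ℕ} {c : ℂ} (h : Admissible x n (c • 1)) {w : SquareAlg}
    {ω : unitInterval → unitInterval} (hw : ∀ z, w z = ((ω z.1 : ℝ) : ℂ)) :
    Admissible x n (c • w) := by
  intro i hi z
  have := h i hi (1, z.2 * ω z.1)
  simp only [Set.Icc.coe_mul, Complex.ofReal_mul, ContinuousMap.one_apply, smul_eq_mul,
    mul_one, ContinuousMap.smul_apply, hw] at this ⊢
  convert this using 1
  ring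

theorem Admissible.isUnit {x : ℕ → ℂ} {n : ℕ} {ρ : SquareAlg} (h : Admissible x (n + 1) ρ) :
    IsUnit (1 - sndVar * (x n • ρ)) := by
  rw [isUnit_iff]
  intro z
  have := h n (by omega) z
  simp only [Nat.Ico_succ_singleton, Finset.prod_singleton] at this
  simpa [sub_ne_zero] using this.symm

theorem analyticAt_inverse_of_isUnit {E : Type*} [NormedAddCommGroup E] [NormedSpace ℂ E]
    {f : E → SquareAlg} {e : E} (hf : AnalyticAt ℂ f e) (hu : IsUnit (f e)) :
    AnalyticAt ℂ (fun y => Ring.inverse (f y)) e := by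
  obtain ⟨a, ha⟩ := hu
  have := analyticAt_inverse (𝕜 := ℂ) a
  rw [ha] at this
  exact this.comp hf

/-- Each stage is a product, a bounded linear map and an inverse in `SquareAlg`, all analytic;
admissibility makes the denominators units. No differentiation under the integral sign is needed. -/
theorem analyticAt_iter {E : Type*} [NormedAddCommGroup E] [NormedSpace ℂ E] {X : E → ℕ → ℂ}
    {e : E} (n : ℕ) (hX : ∀ i < n, AnalyticAt ℂ (fun y => X y i) e) {R : E → SquareAlg}
    (hR : AnalyticAt ℂ R e) (h : Admissible (X e) n (R e)) :
    AnalyticAt ℂ (fun y => iter (X y) n (R y)) e := by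
  induction n generalizing R with
  | zero => exact analyticAt_const
  | succ n ih =>
    have hσ : AnalyticAt ℂ (fun y => X y n • R y) e := (hX n (by omega)).smul hR
    have h1 := ih (fun i hi => hX i (by omega)) hσ h.pred
    have h2 := analyticAt_inverse_of_isUnit
      (analyticAt_const.sub (analyticAt_const.mul hσ) :
        AnalyticAt ℂ (fun y => 1 - sndVar * (X y n • R y)) e) h.isUnit
    exact analyticAt_const.mul ((rayMean.analyticAt _).comp ((h1.mul hσ).mul h2))

theorem analyticAt_iterDiff {E : Type*} [NormedAddCommGroup E] [NormedSpace ℂ E] {X : E → ℕ → ℂ}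
    {e : E} (n : ℕ) (hX : ∀ i < n, AnalyticAt ℂ (fun y => X y i) e) {W R : E → SquareAlg}
    (hW : AnalyticAt ℂ W e) (hR : AnalyticAt ℂ R e) (h : Admissible (X e) n (R e))
    (hw : Admissible (X e) n (W e * R e)) :
    AnalyticAt ℂ (fun y => iterDiff (X y) (W y) n (R y)) e := by
  induction n generalizing R with
  | zero => exact analyticAt_const
  | succ n ih =>
    have hσ : AnalyticAt ℂ (fun y => X y n • R y) e := (hX n (by omega)).smul hR
    have hwp := hw.pred
    have hwu := hw.isUnit
    rw [← mul_smul_comm] at hwp hwu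
    have h0 := ih (fun i hi => hX i (by omega)) hσ h.pred hwp
    have h1 := analyticAt_iter n (fun i hi => hX i (by omega)) hσ h.pred
    have h2 := analyticAt_inverse_of_isUnit
      (analyticAt_const.sub (analyticAt_const.mul hσ) :
        AnalyticAt ℂ (fun y => 1 - sndVar * (X y n • R y)) e) h.isUnit
    have h3 := analyticAt_inverse_of_isUnit
      (analyticAt_const.sub (analyticAt_const.mul (hW.mul hσ)) :
        AnalyticAt ℂ (fun y => 1 - sndVar * (W y * (X y n • R y))) e) hwu
    exact analyticAt_const.mul ((rayMean.analyticAt _).comp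
      (((h0.mul (hW.mul hσ)).mul h3).add ((h1.mul hσ).mul (h3.mul h2))))

/-- Multiplication by a function of `u` alone commutes with `rayMean`. -/
theorem rayMean_mul {w : SquareAlg} (hw : ∀ u t t', w (u, t) = w (u, t')) (f : SquareAlg) :
    rayMean (w * f) = w * rayMean f := by
  ext z
  rw [ContinuousMap.mul_apply, rayMean_apply, rayMean_apply, ← MeasureTheory.integral_const_mul]
  congr 1
  ext v
  rw [ContinuousMap.mul_apply, hw z.1 (z.2 * v) z.2]

/-- The recursion of `iterDiff` is the product rule for divided differences. It never divides by `w
- 1`, so `iterDiff` makes sense and is analytic where `w` takes the value `1`; this is what makes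
`regularPart` regular on the divisor. -/
theorem iter_sub_iter {x : ℕ → ℂ} {w : SquareAlg} (hw : ∀ u t t', w (u, t) = w (u, t'))
    (n : ℕ) {ρ : SquareAlg} (h : Admissible x n ρ) (hwρ : Admissible x n (w * ρ)) :
    iter x n (w * ρ) - iter x n ρ = (w - 1) * iterDiff x w n ρ := by
  induction n generalizing ρ with
  | zero => simp [iter, iterDiff]
  | succ n ih =>
    have hwp := hwρ.pred
    have hwu := hwρ.isUnit
    rw [← mul_smul_comm] at hwp hwu
    have key := ih h.pred hwp
    have hu := h.isUnit
    have i1 := Ring.mul_inverse_cancel _ hwu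
    have i2 := Ring.mul_inverse_cancel _ hu
    simp only [iter, iterDiff, ← mul_smul_comm]
    rw [← mul_sub, ← map_sub, mul_left_comm (w - 1) sndVar, ← rayMean_mul (w := w - 1)
      (fun u t t' => by simp [hw u t t'])]
    congr 2
    -- With `t = sndVar`, `a = 1 / (1 - t w σ)` and `c = 1 / (1 - t σ)`, the point is `w σ a - σ c =
    -- (w - 1) σ a c`.
    generalize Ring.inverse (1 - sndVar * (w * x n • ρ)) = a at *
    generalize Ring.inverse (1 - sndVar * x n • ρ) = c at *
    generalize x n • ρ = σ at *
    rw [eq_add_of_sub_eq key]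
    linear_combination (iter x n σ * σ * c) * i1 - (iter x n σ * w * σ * a) * i2

theorem iter_congr {x x' : ℕ → ℂ} {n : ℕ} (h : ∀ i < n, x i = x' i) (ρ : SquareAlg) :
    iter x n ρ = iter x' n ρ := by
  induction n generalizing ρ with
  | zero => rfl
  | succ n ih => simp only [iter, h n (by omega), ih fun i hi => h i (by omega)]

/-- Scaling the last variable of `iter` amounts to shortening the ray. -/
theorem iter_smul_apply (x : ℕ → ℂ) (n : ℕ) (c : ℂ) (h : Admissible x n (c • 1)) {w : SquareAlg}
    {ω : unitInterval → unitInterval} (hw : ∀ z, w z = ((ω z.1 : ℝ) : ℂ)) (u t v : unitInterval) :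
    iter x n (c • w) (u, t) = iter x n (c • 1) (v, ω u * t) := by
  induction n generalizing c t with
  | zero => simp [iter]
  | succ n ih =>
    have hp := h.pred
    have hu := h.isUnit
    have hu' := (h.smul hw).isUnit
    rw [smul_smul] at hp hu hu'
    simp only [iter, ContinuousMap.mul_apply, rayMean_apply, sndVar_apply, smul_smul,
      inverse_apply hu, inverse_apply hu', ih _ hp, ContinuousMap.smul_apply,
      ContinuousMap.sub_apply, ContinuousMap.one_apply, hw,
      smul_eq_mul, mul_one, Set.Icc.coe_mul, Complex.ofReal_mul]
    rw [mul_comm ((ω u : ℝ) : ℂ), mul_assoc ((t : ℝ) : ℂ) ((ω u : ℝ) : ℂ),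
      ← MeasureTheory.integral_const_mul ((ω u : ℝ) : ℂ)]
    congr 2
    ext s
    rw [mul_assoc (ω u) t s]
    ring_nf

theorem integral_unitInterval (f : ℝ → ℂ) :
    ∫ v : unitInterval, f v = ∫ v in (0 : ℝ)..1, f v := by
  rw [MeasureTheory.integral_subtype (s := unitInterval) measurableSet_Icc f, unitInterval,
    MeasureTheory.integral_Icc_eq_integral_Ioc, ← intervalIntegral.integral_of_le zero_le_one]

/-- The integral along the ray at height `u` has the integrand as its derivative at the end. -/
theorem exists_hasDerivAt_rayMean (f : SquareAlg) (u : unitInterval) :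
    ∃ F : ℝ → ℂ, HasDerivAt F (f (u, 1)) 1 ∧
      ∀ τ : unitInterval, F τ = (sndVar * rayMean f) (u, τ) := by
  -- Clamping extends the integrand continuously beyond `1`, so the primitive has a two-sided
  -- derivative at the end point.
  let g : ℝ → ℂ := fun v => f (u, Set.projIcc 0 1 zero_le_one v)
  have hg : Continuous g := f.continuous.comp (by fun_prop)
  refine ⟨fun τ => ∫ v in (0 : ℝ)..τ, g v, ?_, fun τ => ?_⟩
  · have h := intervalIntegral.integral_hasDerivAt_right (hg.intervalIntegrable 0 1)
      hg.stronglyMeasurable.stronglyMeasurableAtFilter hg.continuousAt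
    have e : g 1 = f (u, 1) := by
      show f (u, Set.projIcc 0 1 zero_le_one 1) = _
      rw [Set.projIcc_right]
      rfl
    rwa [e] at h
  · have h1 : ∀ v : unitInterval, f (u, τ * v) = g (τ * v) := by
      intro v
      show _ = f (u, Set.projIcc 0 1 zero_le_one ((τ * v : unitInterval) : ℝ))
      rw [Set.projIcc_val]
    have h2 := intervalIntegral.smul_integral_comp_mul_left (a := 0) (b := 1) g (τ : ℝ)
    rw [ContinuousMap.mul_apply, rayMean_apply, sndVar_apply]
    simp only [h1]
    rw [integral_unitInterval fun v => g (τ * v)]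
    rw [mul_zero, mul_one, Complex.real_smul] at h2
    exact h2.symm

/-- The mean `f ↦ ∫₀¹ f (u, 1) du` along the top edge of the square. -/
noncomputable def topMean : SquareAlg →L[ℂ] ℂ :=
  LinearMap.mkContinuous
    { toFun := fun f => ∫ u : unitInterval, f (u, 1)
      map_add' := fun f g => MeasureTheory.integral_add (integrable_of_continuous (by fun_prop))
          (integrable_of_continuous (by fun_prop))
      map_smul' := fun c f => MeasureTheory.integral_const_mul c _ } 1 fun f => by
    have := MeasureTheory.norm_integral_le_of_norm_le_const
      (μ := (MeasureTheory.volume : MeasureTheory.Measure unitInterval))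
      (f := fun u => f (u, 1)) (C := ‖f‖)
      (Eventually.of_forall fun v => f.norm_coe_le_norm _)
    simpa using this

theorem topMean_apply (f : SquareAlg) : topMean f = ∫ u : unitInterval, f (u, 1) := rfl

/-! ### Power series of the iterated integral on the polydisc. -/

/-- The largest entry of an increasing tuple, `0` for the empty one. -/
def IncTuple.top {n : ℕ} (k : IncTuple n) : ℕ := Finset.univ.sup k.1

theorem IncTuple.le_top {n : ℕ} (k : IncTuple n) (i : Fin n) : k.1 i ≤ k.top :=
  Finset.le_sup (Finset.mem_univ i)

/-- An increasing tuple with `l + 1` more than its largest entry appended. -/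
def IncTuple.snoc {n : ℕ} (k : IncTuple n) (l : ℕ) : IncTuple (n + 1) :=
  ⟨Fin.snoc (α := fun _ => ℕ) k.1 (k.top + l + 1), by
    constructor
    · intro i j hij
      induction j using Fin.lastCases with
      | last =>
        obtain ⟨i, rfl⟩ := Fin.eq_castSucc_of_ne_last hij.ne
        have := k.le_top i
        simp only [Fin.snoc_castSucc, Fin.snoc_last]
        omega
      | cast j =>
        obtain ⟨i, rfl⟩ := Fin.eq_castSucc_of_ne_last (hij.trans (Fin.castSucc_lt_last j)).ne
        simp only [Fin.snoc_castSucc]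
        exact k.2.1 (Fin.castSucc_lt_castSucc_iff.1 hij)
    · intro i
      induction i using Fin.lastCases with
      | last => simp
      | cast i => simpa using k.2.2 i⟩

/-- An increasing tuple without its last entry. -/
def IncTuple.init {n : ℕ} (k : IncTuple (n + 1)) : IncTuple n :=
  ⟨fun i => k.1 i.castSucc, fun _ _ h => k.2.1 (Fin.castSucc_lt_castSucc_iff.2 h),
    fun _ => k.2.2 _⟩

theorem IncTuple.top_init_lt {n : ℕ} (k : IncTuple (n + 1)) : k.init.top < k.1 (Fin.last n) :=
  (Finset.sup_lt_iff (k.2.2 _)).2 fun i _ => k.2.1 (Fin.castSucc_lt_last i)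

@[simp] theorem IncTuple.top_snoc {n : ℕ} (k : IncTuple n) (l : ℕ) :
    (k.snoc l).top = k.top + l + 1 := by
  apply le_antisymm
  · refine Finset.sup_le fun i _ => ?_
    have := (k.snoc l).2.1.monotone (Fin.le_last i)
    simpa [IncTuple.snoc] using this
  · have := (k.snoc l).le_top (Fin.last n)
    simpa [IncTuple.snoc] using this

/-- Increasing tuples of length `n + 1` are increasing tuples of length `n` with an increment. -/
def incTupleSuccEquiv (n : ℕ) : IncTuple n × ℕ ≃ IncTuple (n + 1) where
  toFun p := p.1.snoc p.2
  invFun k := (k.init, k.1 (Fin.last n) - k.init.top - 1)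
  left_inv p := by
    have h : (p.1.snoc p.2).init = p.1 := by
      apply Subtype.ext
      funext i
      simp [IncTuple.init, IncTuple.snoc]
    refine Prod.ext h ?_
    simp only [h]
    simp only [IncTuple.snoc, Fin.snoc_last]
    omega
  right_inv k := by
    apply Subtype.ext
    funext i
    induction i using Fin.lastCases with
    | last =>
      have := k.top_init_lt
      simp only [IncTuple.snoc, Fin.snoc_last]
      omega
    | cast i => simp [IncTuple.init, IncTuple.snoc]

/-- The coefficient `∏ x_i ^ k_i / k_i`. -/
noncomputable def IncTuple.coeff (x : ℕ → ℂ) {n : ℕ} (k : IncTuple n) : ℂ :=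
  ∏ i : Fin n, x i ^ k.1 i / (k.1 i : ℂ)

theorem IncTuple.coeff_snoc (x : ℕ → ℂ) {n : ℕ} (k : IncTuple n) (l : ℕ) :
    (k.snoc l).coeff x = k.coeff x * (x n ^ (k.top + l + 1) / ((k.top + l + 1 : ℕ) : ℂ)) := by
  simp only [IncTuple.coeff, Fin.prod_univ_castSucc]
  simp [IncTuple.snoc]

theorem norm_sndVar_le : ‖sndVar‖ ≤ 1 := by
  refine (ContinuousMap.norm_le _ zero_le_one).2 fun z => ?_
  rw [sndVar_apply, Complex.norm_real, Real.norm_eq_abs, abs_of_nonneg z.2.2.1]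
  exact z.2.2.2

theorem rayMean_sndVar_pow (m : ℕ) :
    rayMean (sndVar ^ m) = ((m + 1 : ℕ) : ℂ)⁻¹ • sndVar ^ m := by
  ext z
  have h : ∫ v : unitInterval, ((v : ℝ) : ℂ) ^ m = ((m + 1 : ℕ) : ℂ)⁻¹ := by
    rw [integral_unitInterval fun v : ℝ => (v : ℂ) ^ m]
    have h2 : ∫ v in (0 : ℝ)..1, (v : ℂ) ^ m = ((∫ v in (0 : ℝ)..1, v ^ m : ℝ) : ℂ) := by
      rw [← intervalIntegral.integral_ofReal]
      simp
    rw [h2, integral_pow]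
    simp
  simp only [rayMean_apply, ContinuousMap.pow_apply, sndVar_apply, ContinuousMap.smul_apply,
    Set.Icc.coe_mul, Complex.ofReal_mul, mul_pow, smul_eq_mul]
  rw [MeasureTheory.integral_const_mul, h, mul_comm]

theorem summable_norm_coeff {x : ℕ → ℂ} {n : ℕ} (hx : ∀ i < n, ‖x i‖ < 1) :
    Summable fun k : IncTuple n => ‖k.coeff x‖ := by
  induction n with
  | zero =>
    have : Finite (IncTuple 0) := Subtype.finite
    exact Summable.of_finite
  | succ n ih =>
    rw [← (incTupleSuccEquiv n).summable_iff]
    have hr : ‖x n‖ < 1 := hx n (by omega)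
    have h1 := (ih fun i hi => hx i (by omega)).mul_of_nonneg
      (summable_geometric_of_lt_one (norm_nonneg _) hr) (fun _ => norm_nonneg _)
      (fun _ => by positivity)
    refine Summable.of_nonneg_of_le (fun _ => norm_nonneg _) (fun p => ?_) h1
    show ‖(p.1.snoc p.2).coeff x‖ ≤ ‖p.1.coeff x‖ * ‖x n‖ ^ p.2
    rw [IncTuple.coeff_snoc, norm_mul, norm_div, norm_pow]
    gcongr
    have h2 : (1 : ℝ) ≤ ‖((p.1.top + p.2 + 1 : ℕ) : ℂ)‖ := by
      rw [Complex.norm_natCast]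
      exact_mod_cast Nat.le_add_left 1 _
    calc ‖x n‖ ^ (p.1.top + p.2 + 1) / ‖((p.1.top + p.2 + 1 : ℕ) : ℂ)‖
        ≤ ‖x n‖ ^ (p.1.top + p.2 + 1) := div_le_self (by positivity) h2
      _ ≤ ‖x n‖ ^ p.2 := pow_le_pow_of_le_one (norm_nonneg _) hr.le (by omega)

theorem norm_smul_sndVar_pow_le {ρ : ℂ} (hρ : ‖ρ‖ ≤ 1) (m : ℕ) : ‖(ρ • sndVar) ^ m‖ ≤ 1 := by
  refine (norm_pow_le _ _).trans (pow_le_one₀ (norm_nonneg _) ?_)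
  rw [norm_smul]
  exact mul_le_one₀ hρ (norm_nonneg _) norm_sndVar_le

theorem summable_norm_coeff_smul {x : ℕ → ℂ} {n : ℕ} (hx : ∀ i < n, ‖x i‖ < 1) {ρ : ℂ}
    (hρ : ‖ρ‖ ≤ 1) :
    Summable fun k : IncTuple n => ‖k.coeff x • (ρ • sndVar) ^ k.top‖ := by
  refine Summable.of_nonneg_of_le (fun _ => norm_nonneg _) (fun k => ?_) (summable_norm_coeff hx)
  rw [norm_smul]
  exact mul_le_of_le_one_right (norm_nonneg _) (norm_smul_sndVar_pow_le hρ _)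

/-- Expand `1 / (1 - t a)` as a geometric series whose exponent is the gap to the next index;
integrating `t ^ (k - 1)` from `0` supplies the denominator `k` of the new largest index. -/
theorem hasSum_iter {x : ℕ → ℂ} {n : ℕ} (hx : ∀ i < n, ‖x i‖ < 1) {ρ : ℂ} (hρ : ‖ρ‖ ≤ 1) :
    HasSum (fun k : IncTuple n => k.coeff x • (ρ • sndVar) ^ k.top) (iter x n (ρ • 1)) := by
  induction n generalizing ρ with
  | zero =>
    have : Unique (IncTuple 0) :=
      { default := ⟨Fin.elim0, fun i => i.elim0, fun i => i.elim0⟩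
        uniq := fun k => Subtype.ext (Subsingleton.elim _ _) }
    have h := hasSum_unique fun k : IncTuple 0 => k.coeff x • (ρ • sndVar) ^ k.top
    have e : (default : IncTuple 0).coeff x • (ρ • sndVar) ^ (default : IncTuple 0).top = 1 := by
      simp [IncTuple.coeff, IncTuple.top]
    rw [e] at h
    exact h
  | succ n ih =>
    rw [← (incTupleSuccEquiv n).hasSum_iff]
    have hx' : ∀ i < n, ‖x i‖ < 1 := fun i hi => hx i (by omega)
    have hr : ‖x n‖ < 1 := hx n (by omega)
    set a : ℂ := x n * ρ with ha
    have ha1 : ‖a‖ < 1 := by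
      rw [ha, norm_mul]
      exact (mul_le_of_le_one_right (norm_nonneg _) hρ).trans_lt hr
    have hgn : ‖a • sndVar‖ < 1 := by
      rw [norm_smul]
      exact (mul_le_of_le_one_right (norm_nonneg _) norm_sndVar_le).trans_lt ha1
    have h1 := ih hx' ha1.le
    have hsum := summable_geometric_of_norm_lt_one hgn
    have h2 : HasSum (fun l : ℕ => (a • sndVar) ^ l)
        (Ring.inverse (1 - sndVar * (a • (1 : SquareAlg)))) := by
      have e : sndVar * (a • (1 : SquareAlg)) = a • sndVar := by simp
      rw [e, NormedRing.inverse_one_sub _ hgn]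
      exact hsum.hasSum
    have h2n : Summable fun l : ℕ => ‖(a • sndVar) ^ l‖ :=
      (summable_geometric_of_lt_one (norm_nonneg _) hgn).of_nonneg_of_le
        (fun _ => norm_nonneg _) fun l => norm_pow_le _ _
    have hmn : Summable fun p : IncTuple n × ℕ =>
        ‖p.1.coeff x • (a • sndVar) ^ p.1.top * (a • sndVar) ^ p.2‖ :=
      Summable.mul_norm (f := fun k : IncTuple n => k.coeff x • (a • sndVar) ^ k.top)
        (g := fun l : ℕ => (a • sndVar) ^ l) (summable_norm_coeff_smul hx' ha1.le) h2n
    have h3 := h1.mul h2 hmn.of_norm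
    have h4 := ((h3.mul_left (a • (1 : SquareAlg))).mapL rayMean).mul_left sndVar
    have hit : iter x (n + 1) (ρ • 1) = sndVar * rayMean (a • (1 : SquareAlg) *
        (iter x n (a • 1) * Ring.inverse (1 - sndVar * a • (1 : SquareAlg)))) := by
      simp only [iter, smul_smul, ← ha]
      congr 2
      ring
    rw [hit]
    refine (congrArg (fun f => HasSum f _) (funext fun p => ?_)).mpr h4
    show (p.1.snoc p.2).coeff x • (ρ • sndVar) ^ (p.1.snoc p.2).top = _
    have e : a • (1 : SquareAlg) * (p.1.coeff x • (a • sndVar) ^ p.1.top * (a • sndVar) ^ p.2)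
        = (p.1.coeff x * a ^ (p.1.top + p.2 + 1)) • sndVar ^ (p.1.top + p.2) := by
      ext z
      simp only [ContinuousMap.mul_apply, ContinuousMap.smul_apply, ContinuousMap.pow_apply,
        ContinuousMap.one_apply, smul_eq_mul]
      ring
    rw [e, map_smul, rayMean_sndVar_pow, IncTuple.coeff_snoc, IncTuple.top_snoc, ha, smul_smul,
      mul_smul_comm, ← pow_succ', smul_pow, smul_smul]
    congr 1
    rw [mul_pow]
    ring

/-- On the polydisc the iterated integral is the power series of the multiple logarithm. -/
theorem hasSum_iter_apply_one {x : ℕ → ℂ} {n : ℕ} (hx : ∀ i < n, ‖x i‖ < 1) :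
    HasSum (fun k : IncTuple n => k.coeff x) (iter x n 1 (1, 1)) := by
  have h := (hasSum_iter hx (ρ := 1) (by simp)).map
    (ContinuousMap.evalCLM ℂ ((1, 1) : unitInterval × unitInterval)) (ContinuousLinearMap.continuous _)
  simpa [Function.comp_def] using h

theorem iter_ne_zero_of_pos {n : ℕ} {r : ℝ} (h0 : 0 < r) (h1 : r < 1) :
    iter (fun _ => (r : ℂ)) n 1 (1, 1) ≠ 0 := by
  have h := hasSum_iter_apply_one (x := fun _ => (r : ℂ)) (n := n)
    fun i _ => by rwa [Complex.norm_real, Real.norm_of_nonneg h0.le]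
  have e : ∀ k : IncTuple n, k.coeff (fun _ => (r : ℂ)) =
      ((∏ i : Fin n, r ^ k.1 i / (k.1 i : ℝ) : ℝ) : ℂ) := by
    intro k
    simp [IncTuple.coeff]
  have hpos : ∀ k : IncTuple n, 0 < ∏ i : Fin n, r ^ k.1 i / (k.1 i : ℝ) := fun k =>
    Finset.prod_pos fun i _ => div_pos (pow_pos h0 _) (Nat.cast_pos.2 (k.2.2 i))
  simp only [e] at h
  intro hz
  rw [hz, ← Complex.ofReal_zero, Complex.hasSum_ofReal] at h
  -- All terms are positive, so the single tuple `(1, 2, …, n)` already forces a positive sum.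
  let k₀ : IncTuple n := ⟨fun i => i + 1, fun i j h => by simpa using h, fun i => by simp⟩
  exact (hpos k₀).not_ge (le_hasSum h k₀ fun k _ => (hpos k).le)

/-! ### Functions of each depth, and loops with trivial monodromy. -/

/-- The coordinates of a point of `ℂⁿ`, continued by `1`. -/
noncomputable def coords {n : ℕ} (x : Fin n → ℂ) (i : ℕ) : ℂ :=
  if h : i < n then x ⟨i, h⟩ else 1

@[simp] theorem coords_val {n : ℕ} (x : Fin n → ℂ) (i : Fin n) : coords x i = x i := by
  simp [coords]

theorem analyticAt_coords {n : ℕ} (i : ℕ) (a : Fin n → ℂ) :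
    AnalyticAt ℂ (fun x => coords x i) a := by
  unfold coords
  split_ifs with h
  · exact (ContinuousLinearMap.proj (R := ℂ) (φ := fun _ : Fin n => ℂ) ⟨i, h⟩).analyticAt a
  · exact analyticAt_const

theorem consecProd_eq {n : ℕ} (i j : Fin n) (x : Fin n → ℂ) :
    consecProd i j x = ∏ k ∈ Finset.Ico (i : ℕ) (j + 1), coords x k := by
  have h : Finset.Ico (i : ℕ) (j + 1) = (Finset.Icc i j).map Fin.valEmbedding := by
    rw [Fin.map_valEmbedding_Icc]
    ext k
    simp only [Finset.mem_Ico, Finset.mem_Icc]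
    omega
  rw [h, Finset.prod_map]
  simp [consecProd]

theorem norm_prod_coords_lt_one {n : ℕ} {x : Fin n → ℂ} (hx : ∀ k, ‖x k‖ < 1) {i j : ℕ}
    (hij : i < j) (hj : j ≤ n) : ‖∏ k ∈ Finset.Ico i j, coords x k‖ < 1 := by
  have h : ∀ k < n, ‖coords x k‖ < 1 := fun k hk => by
    rw [coords, dif_pos hk]
    exact hx _
  rw [norm_prod, Finset.prod_eq_prod_Ico_succ_bot hij]
  exact (mul_le_of_le_one_right (norm_nonneg _) (Finset.prod_le_one (fun _ _ => norm_nonneg _)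
    fun k hk => (h k (by simp at hk; omega)).le)).trans_lt (h i (by omega))

theorem mul_ne_one_of_norm_lt_one {c : ℂ} (hc : ‖c‖ < 1) (t : unitInterval) :
    ((t : ℝ) : ℂ) * c ≠ 1 := by
  intro h
  have h1 := congrArg norm h
  rw [norm_mul, Complex.norm_real, Real.norm_of_nonneg t.2.1, norm_one] at h1
  have := mul_le_of_le_one_left (norm_nonneg c) t.2.2
  linarith

/-- The product of the coordinates from the `i`-th on. -/
noncomputable def tailProd {n : ℕ} (i : ℕ) (x : Fin n → ℂ) : ℂ :=
  ∏ k ∈ Finset.Ico i n, coords x k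

theorem analyticAt_prod_coords {n : ℕ} (i j : ℕ) (a : Fin n → ℂ) :
    AnalyticAt ℂ (fun x => ∏ k ∈ Finset.Ico i j, coords x k) a :=
  Finset.analyticAt_fun_prod _ fun k _ => analyticAt_coords k a

theorem analyticAt_tailProd {n : ℕ} (i : ℕ) (a : Fin n → ℂ) :
    AnalyticAt ℂ (tailProd i) a := analyticAt_prod_coords i n a

/-- The straight ray to the point with coordinates `x_i ⋯ x_{n-1}`, `i < j`, avoids `1`. -/
def TailAdmissible {n : ℕ} (j : ℕ) (x : Fin n → ℂ) : Prop :=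
  ∀ i < j, ∀ t : unitInterval, ((t : ℝ) : ℂ) * tailProd i x ≠ 1

theorem TailAdmissible.admissible {n j : ℕ} (hj : j ≤ n) {x : Fin n → ℂ}
    (h : TailAdmissible j x) : Admissible (coords x) j (tailProd j x • 1) := by
  intro i hi z
  have := h i hi z.2
  rw [tailProd, ← Finset.prod_Ico_consecutive _ hi.le hj] at this
  simpa [tailProd] using this

/-- The multiple logarithm of depth `j` in the variables `x_0, …, x_{j-2}, x_{j-1} ⋯ x_{n-1}`. -/
noncomputable def depthLog {n : ℕ} (j : ℕ) (x : Fin n → ℂ) : ℂ :=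
  iter (coords x) j (tailProd j x • 1) (1, 1)

theorem analyticAt_eval {E : Type*} [NormedAddCommGroup E] [NormedSpace ℂ E] {f : E → SquareAlg}
    {e : E} (hf : AnalyticAt ℂ f e) (z : unitInterval × unitInterval) :
    AnalyticAt ℂ (fun y => f y z) e :=
  (ContinuousLinearMap.analyticAt (ContinuousMap.evalCLM ℂ z : SquareAlg →L[ℂ] ℂ) (f e)).comp hf

theorem analyticAt_depthLog {n j : ℕ} (hj : j ≤ n) {x : Fin n → ℂ} (h : TailAdmissible j x) :
    AnalyticAt ℂ (depthLog j) x :=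
  analyticAt_eval (analyticAt_iter j (fun i _ => analyticAt_coords i x)
    ((analyticAt_tailProd j x).smul analyticAt_const) (h.admissible hj)) _

theorem tailAdmissible_of_norm_lt_one {n j : ℕ} (hj : j ≤ n) {x : Fin n → ℂ}
    (hx : ∀ k, ‖x k‖ < 1) : TailAdmissible j x := fun _ hi _ =>
  mul_ne_one_of_norm_lt_one (norm_prod_coords_lt_one hx (hi.trans_le hj) le_rfl) _

theorem multiLog_eq_depthLog {n : ℕ} {x : Fin n → ℂ} (hx : ∀ k, ‖x k‖ < 1) :
    multiLog n x = depthLog n x := by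
  have h := hasSum_iter_apply_one (x := coords x) (n := n) fun i hi => by
    rw [coords, dif_pos hi]
    exact hx _
  have e : tailProd n x = 1 := by simp [tailProd]
  rw [depthLog, e, one_smul, ← h.tsum_eq, multiLog]
  simp [IncTuple.coeff]

theorem isOpen_polydisc (n : ℕ) : IsOpen {x : Fin n → ℂ | ∀ k, ‖x k‖ < 1} := by
  simp only [Set.ofPred_forall]
  exact isOpen_iInter_of_finite fun k => isOpen_lt (by fun_prop) continuous_const

theorem multiLog_eventuallyEq {n : ℕ} {b : Fin n → ℂ} (hb : ∀ k, ‖b k‖ < 1) :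
    multiLog n =ᶠ[𝓝 b] depthLog n :=
  eventually_of_mem ((isOpen_polydisc n).mem_nhds hb) fun _ hx => multiLog_eq_depthLog hx

/-- A ray that meets the divisor after scaling the product also meets it after scaling the point. -/
theorem mul_consecProd_ne_one {n : ℕ} {b : Fin n → ℂ} {q : Path b b} {i j : Fin n} (hij : i ≤ j)
    (h : ¬ Encloses q i j) (s t : unitInterval) :
    ((t : ℝ) : ℂ) * consecProd i j (q s) ≠ 1 := by
  intro h1
  apply h
  have hm : (j : ℕ) + 1 - i ≠ 0 := by
    have : (i : ℕ) ≤ j := hij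
    omega
  -- Scaling the point by `r` scales the product of `j + 1 - i` coordinates by `r ^ (j + 1 - i)`, so
  -- `r` is the corresponding root of `t`.
  refine ⟨(((t : ℝ) ^ (((j + 1 - i : ℕ) : ℝ)⁻¹) : ℝ) : ℂ) • q s,
    ⟨_, Real.rpow_nonneg t.2.1 _, Real.rpow_le_one t.2.1 t.2.2 (by positivity), s, rfl⟩, ?_⟩
  show ∏ k ∈ Finset.Icc i j, (((t : ℝ) ^ (((j + 1 - i : ℕ) : ℝ)⁻¹) : ℝ) : ℂ) • q s k = 1
  simp only [smul_eq_mul, Finset.prod_mul_distrib, Finset.prod_const, Fin.card_Icc]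
  rw [← Complex.ofReal_pow, Real.rpow_inv_natCast_pow t.2.1 hm]
  exact h1

theorem tailProd_eq_consecProd {n : ℕ} {i l : Fin n} (hl : (l : ℕ) + 1 = n) (x : Fin n → ℂ) :
    tailProd i x = consecProd i l x := by
  rw [consecProd_eq, hl, tailProd]

/-- A loop that encloses no divisor `x_s ⋯ x_n = 1` acts trivially. -/
theorem trivialMonodromy_of_not_encloses {n : ℕ} {b : Fin n → ℂ} (hb : ∀ k, ‖b k‖ < 1)
    {q : Path b b} (h : ∀ s l : Fin n, (l : ℕ) + 1 = n → ¬ Encloses q s l) :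
    TrivialMonodromy q := by
  apply trivialMonodromy_of_continuesTo
  refine (continuesTo_self q fun t => analyticAt_depthLog le_rfl ?_).congr
    (multiLog_eventuallyEq hb).symm (multiLog_eventuallyEq hb).symm
  intro i hi s
  have hl : ((⟨n - 1, by omega⟩ : Fin n) : ℕ) + 1 = n := by
    simp only
    omega
  have := mul_consecProd_ne_one (i := ⟨i, hi⟩) (Fin.le_def.2 (by simp only; omega)) (h _ _ hl) t s
  rwa [← tailProd_eq_consecProd hl] at this

/-! ### Lowering the depth by a differential operator. -/

/-- The vector field `x_{n-1} ∂/∂x_{n-1}` of the last variable. -/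
def lastField {n : ℕ} (x : Fin n → ℂ) : Fin n → ℂ := fun i => if (i : ℕ) + 1 = n then x i else 0

theorem analyticAt_lastField {n : ℕ} (a : Fin n → ℂ) : AnalyticAt ℂ (lastField (n := n)) a := by
  rw [analyticAt_pi_iff]
  intro i
  unfold lastField
  split_ifs
  · exact (ContinuousLinearMap.proj (R := ℂ) (φ := fun _ : Fin n => ℂ) i).analyticAt a
  · exact analyticAt_const

theorem coords_lastField {n : ℕ} (x : Fin n → ℂ) (τ : ℂ) {i : ℕ} (hi : i + 1 < n) :
    coords (x + (τ - 1) • lastField x) i = coords x i := by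
  have h1 : i < n := by omega
  have h2 : i + 1 ≠ n := by omega
  simp [coords, lastField, h1, h2]

theorem tailProd_lastField {n : ℕ} (x : Fin n → ℂ) (τ : ℂ) {i : ℕ} (hi : i < n) :
    tailProd i (x + (τ - 1) • lastField x) = τ * tailProd i x := by
  obtain ⟨m, rfl⟩ : ∃ m, n = m + 1 := ⟨n - 1, by omega⟩
  have h : coords (x + (τ - 1) • lastField x) m = τ * coords x m := by
    simp only [coords, lastField, Nat.lt_succ_self, dite_true, Pi.add_apply, Pi.smul_apply,
      if_true, smul_eq_mul]
    ring
  rw [tailProd, tailProd, Finset.prod_Ico_succ_top (by omega),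
    Finset.prod_Ico_succ_top (by omega), h,
    Finset.prod_congr rfl fun k hk => coords_lastField x τ (by simp at hk; omega)]
  ring

/-- The product of the variables `x_i ⋯ x_{n-1}`, `i ≥ j`, that `depthLog j` does not involve. -/
noncomputable def weight {n : ℕ} (j : ℕ) (x : Fin n → ℂ) : ℂ :=
  ∏ i ∈ Finset.Ico j n, tailProd i x

theorem analyticAt_weight {n : ℕ} (j : ℕ) (a : Fin n → ℂ) : AnalyticAt ℂ (weight j) a :=
  Finset.analyticAt_fun_prod _ fun k _ => analyticAt_tailProd k a

theorem weight_lastField {n : ℕ} (x : Fin n → ℂ) (τ : ℂ) (j : ℕ) :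
    weight j (x + (τ - 1) • lastField x) = τ ^ (n - j) * weight j x := by
  rw [weight, Finset.prod_congr rfl fun i hi =>
    tailProd_lastField x τ (Finset.mem_Ico.1 hi).2, Finset.prod_mul_distrib]
  simp [weight]

theorem weight_eq_mul {n j : ℕ} (hj : j < n) (x : Fin n → ℂ) :
    weight j x = tailProd j x * weight (j + 1) x :=
  Finset.prod_eq_prod_Ico_succ_bot hj _

/-- Only the product `x_j ⋯ x_{n-1}` enters the outermost integral. Moving all of it into `ρ`
isolates the dependence on the last variable, uniformly in whether `j` is the last index. -/
theorem depthLog_succ {n : ℕ} (j : ℕ) (hj : j < n) (x : Fin n → ℂ) :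
    depthLog (j + 1) x = iter (Function.update (coords x) j 1) (j + 1) (tailProd j x • 1) (1, 1) := by
  have h : ∀ ρ, iter (Function.update (coords x) j 1) j ρ = iter (coords x) j ρ :=
    iter_congr fun i hi => Function.update_of_ne hi.ne _ _
  have e : coords x j * tailProd (j + 1) x = tailProd j x :=
    (Finset.prod_eq_prod_Ico_succ_bot hj _).symm
  simp only [depthLog, iter, h, smul_smul, Function.update_self, one_mul, e]

theorem admissible_update {n j : ℕ} (hj : j < n) {x : Fin n → ℂ} (h : TailAdmissible (j + 1) x) :
    Admissible (Function.update (coords x) j 1) (j + 1) (tailProd j x • 1) := by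
  intro i hi z
  have := h i hi z.2
  have hij : i ≤ j := by omega
  rw [Finset.prod_Ico_succ_top hij, Function.update_self,
    Finset.prod_congr rfl fun k hk => Function.update_of_ne (Finset.mem_Ico.1 hk).2.ne _ _]
  rw [tailProd, ← Finset.prod_Ico_consecutive _ hij hj.le] at this
  simpa [tailProd] using this

/-- Scaling the last variable moves the end point of the ray. -/
theorem depthLog_lastField {n j : ℕ} (hj : j < n) {x : Fin n → ℂ} (h : TailAdmissible (j + 1) x)
    (τ : unitInterval) :
    depthLog (j + 1) (x + (((τ : ℝ) : ℂ) - 1) • lastField x) =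
      iter (Function.update (coords x) j 1) (j + 1) (tailProd j x • 1) (1, τ) := by
  rw [depthLog_succ j hj, tailProd_lastField x _ hj]
  have h1 := iter_smul_apply (Function.update (coords x) j 1) (j + 1) (tailProd j x)
    (admissible_update hj h) (w := ((τ : ℝ) : ℂ) • 1) (ω := fun _ => τ) (fun z => by simp) 1 1 1
  rw [mul_one, smul_smul, mul_comm] at h1
  rw [← h1]
  congr 1
  apply iter_congr
  intro i hi
  rcases eq_or_ne i j with rfl | hne
  · simp
  · rw [Function.update_of_ne hne, Function.update_of_ne hne, coords_lastField]
    omega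

/-- The differential operator that lowers the depth. -/
noncomputable def lowerDepth {n : ℕ} (j : ℕ) (φ : (Fin n → ℂ) → ℂ) (x : Fin n → ℂ) : ℂ :=
  (1 - tailProd j x) * (fderiv ℂ φ x (lastField x) - ((n - (j + 1) : ℕ) : ℂ) * φ x)

theorem analyticAt_lowerDepth {n : ℕ} (j : ℕ) {a : Fin n → ℂ} {φ : (Fin n → ℂ) → ℂ}
    (h : AnalyticAt ℂ φ a) : AnalyticAt ℂ (lowerDepth j φ) a :=
  (analyticAt_const.sub (analyticAt_tailProd j a)).mul
    (AnalyticAt.sub (AnalyticAt.comp₂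
      ((ContinuousLinearMap.id ℂ ((Fin n → ℂ) →L[ℂ] ℂ)).analyticAt_bilinear _) h.fderiv
      (analyticAt_lastField a)) (analyticAt_const.mul h))

theorem lowerDepth_congr {n : ℕ} (j : ℕ) {a : Fin n → ℂ} {φ ψ : (Fin n → ℂ) → ℂ}
    (h : φ =ᶠ[𝓝 a] ψ) : lowerDepth j φ =ᶠ[𝓝 a] lowerDepth j ψ := by
  filter_upwards [h, h.fderiv (𝕜 := ℂ)] with x h1 h2
  rw [lowerDepth, lowerDepth, h1, h2]

/-- The Euler-type differential equation of the multiple logarithm. -/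
theorem lowerDepth_weight_mul {n j : ℕ} (hj : j < n) {x : Fin n → ℂ}
    (h : TailAdmissible (j + 1) x) :
    lowerDepth j (fun y => weight (j + 1) y * depthLog (j + 1) y) x
      = weight j x * depthLog j x := by
  set φ : (Fin n → ℂ) → ℂ := fun y => weight (j + 1) y * depthLog (j + 1) y with hφ
  set X := Function.update (coords x) j 1 with hX
  set y := tailProd j x with hy
  have hφd : DifferentiableAt ℂ φ x :=
    ((analyticAt_weight _ x).mul (analyticAt_depthLog hj h)).differentiableAt
  have hadm := admissible_update hj h
  have hu := hadm.isUnit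
  have hy1 : y ≠ 1 := by simpa using h j (by omega) 1
  obtain ⟨F, hF, hFeq⟩ := exists_hasDerivAt_rayMean (iter X j (X j • y • 1) * (X j • y • 1) *
    Ring.inverse (1 - sndVar * (X j • y • 1))) 1
  have hint : (iter X j (X j • y • 1) * (X j • y • 1) *
      Ring.inverse (1 - sndVar * (X j • y • 1)) : SquareAlg) (1, 1)
      = depthLog j x * y * (1 - y)⁻¹ := by
    have hXj : X j = 1 := Function.update_self _ _ _
    rw [ContinuousMap.mul_apply, inverse_apply hu]
    simp only [hXj, one_smul, depthLog, ContinuousMap.mul_apply, ContinuousMap.sub_apply,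
      ContinuousMap.smul_apply, ContinuousMap.one_apply, sndVar_apply]
    rw [iter_congr (fun i hi => Function.update_of_ne (ne_of_lt hi) _ _)]
    simp [hy]
  rw [hint] at hF
  have hval : ∀ τ : unitInterval,
      φ (x + (((τ : ℝ) : ℂ) - 1) • lastField x)
        = ((τ : ℝ) : ℂ) ^ (n - (j + 1)) * weight (j + 1) x * F τ := by
    intro τ
    rw [hFeq, hφ]
    simp only
    rw [weight_lastField, depthLog_lastField hj h]
    rfl
  have hd1 : HasDerivAt (fun τ : ℝ => φ (x + ((τ : ℂ) - 1) • lastField x))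
      (fderiv ℂ φ x (lastField x)) 1 := by
    have hline : HasDerivAt (fun τ : ℝ => x + ((τ : ℂ) - 1) • lastField x) (lastField x) 1 := by
      have := ((Complex.ofRealCLM.hasDerivAt (x := (1 : ℝ))).sub_const (1 : ℂ)).smul_const
        (lastField x)
      simpa using this.const_add x
    have hf : HasFDerivAt φ (fderiv ℂ φ x) (x + (((1 : ℝ) : ℂ) - 1) • lastField x) := by
      simpa using hφd.hasFDerivAt
    exact (hf.restrictScalars ℝ).comp_hasDerivAt (1 : ℝ) hline
  have hd2 : HasDerivAt (fun τ : ℝ => (τ : ℂ) ^ (n - (j + 1)) * weight (j + 1) x * F τ)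
      (((n - (j + 1) : ℕ) : ℂ) * weight (j + 1) x * F 1
        + weight (j + 1) x * (depthLog j x * y * (1 - y)⁻¹)) 1 := by
    have hp := ((Complex.ofRealCLM.hasDerivAt (x := (1 : ℝ))).pow (n - (j + 1))).mul_const
      (weight (j + 1) x)
    exact (hp.mul hF).congr_deriv (by simp)
  have hF1 : F 1 = depthLog (j + 1) x := by
    rw [depthLog_succ j hj]
    exact hFeq 1
  have hde : fderiv ℂ φ x (lastField x) = ((n - (j + 1) : ℕ) : ℂ) * weight (j + 1) x * F 1
        + weight (j + 1) x * (depthLog j x * y * (1 - y)⁻¹) := by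
    have hu : UniqueDiffWithinAt ℝ (Set.Icc (0 : ℝ) 1) 1 :=
      uniqueDiffOn_Icc zero_lt_one 1 (by simp)
    -- The formula `hval` is known only for `τ` in `[0, 1]`, so the derivatives at `1` are compared
    -- from the left.
    refine hu.eq_deriv _ hd1.hasDerivWithinAt ?_
    exact hd2.hasDerivWithinAt.congr (fun τ hτ => hval ⟨τ, hτ⟩) (hval 1)
  have hy2 : (1 - y) * (1 - y)⁻¹ = 1 := mul_inv_cancel₀ (sub_ne_zero.2 hy1.symm)
  rw [lowerDepth, hde, hF1, weight_eq_mul hj, ← hy, hφ]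
  linear_combination weight (j + 1) x * depthLog j x * y * hy2

/-- If the principal branch continues to itself, so does each function of lower depth. -/
theorem continuesTo_weight_mul {n : ℕ} {b : Fin n → ℂ} (hb : ∀ k, ‖b k‖ < 1) {q : Path b b}
    (h : ContinuesTo q (multiLog n) (multiLog n)) {j : ℕ} (hj : j ≤ n) :
    ContinuesTo q (fun x => weight j x * depthLog j x) (fun x => weight j x * depthLog j x) := by
  induction hj using Nat.decreasingInduction with
  | self =>
    have e : multiLog n =ᶠ[𝓝 b] fun x => weight n x * depthLog n x := by
      simpa [weight] using multiLog_eventuallyEq hb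
    exact h.congr e e
  | of_succ j hj ih =>
    have e : lowerDepth j (fun x => weight (j + 1) x * depthLog (j + 1) x) =ᶠ[𝓝 b]
        fun x => weight j x * depthLog j x :=
      eventually_of_mem ((isOpen_polydisc n).mem_nhds hb) fun x hx =>
        lowerDepth_weight_mul hj (tailAdmissible_of_norm_lt_one hj hx)
    exact (ih.map (lowerDepth j) (fun _ _ => analyticAt_lowerDepth j)
      (fun _ _ _ => lowerDepth_congr j)).congr e e

/-! ### Branches of the logarithm and their continuation. -/

/-- The branch of `log u` near `exp c` with value `c` at `exp c`. -/
noncomputable def logBranch (c u : ℂ) : ℂ := c + Complex.log (u / Complex.exp c)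

theorem exp_logBranch {c u : ℂ} (hu : u ≠ 0) : Complex.exp (logBranch c u) = u := by
  rw [logBranch, Complex.exp_add, Complex.exp_log (div_ne_zero hu (Complex.exp_ne_zero _))]
  field_simp [Complex.exp_ne_zero]

/-- Since `1 + π / 2 < π`, the difference of `logBranch c u` and `c'` stays in the strip where
`Complex.log` inverts `exp`. -/
theorem logBranch_eq {c c' u : ℂ} (hu : u ≠ 0) (h : ‖Complex.log (u / Complex.exp c)‖ < 1)
    (hc : |(c - c').im| ≤ Real.pi / 2) : logBranch c' u = logBranch c u := by
  have him : |(logBranch c u - c').im| < Real.pi := by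
    have h1 := (Complex.abs_im_le_norm (Complex.log (u / Complex.exp c))).trans_lt h
    have e : (logBranch c u - c').im = (c - c').im + (Complex.log (u / Complex.exp c)).im := by
      simp only [logBranch, Complex.sub_im, Complex.add_im]
      ring
    rw [e]
    have := abs_add_le (c - c').im (Complex.log (u / Complex.exp c)).im
    have := Real.pi_gt_three
    linarith
  have e : u / Complex.exp c' = Complex.exp (logBranch c u - c') := by
    rw [Complex.exp_sub, exp_logBranch hu]
  rw [logBranch, e, Complex.log_exp (abs_lt.1 him).1 (abs_lt.1 him).2.le]
  ring

theorem eventually_norm_log_div_exp_lt (c : ℂ) :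
    ∀ᶠ u in 𝓝 (Complex.exp c), u ≠ 0 ∧ ‖Complex.log (u / Complex.exp c)‖ < 1 := by
  have hc : ContinuousAt (fun u => ‖Complex.log (u / Complex.exp c)‖) (Complex.exp c) := by
    refine ((continuousAt_clog ?_).comp (continuousAt_id.div_const _)).norm
    simp [Complex.exp_ne_zero]
  refine (continuousAt_id.eventually_ne (Complex.exp_ne_zero c)).and (hc.eventually_lt_const ?_)
  simp [Complex.exp_ne_zero]

theorem analyticAt_logBranch {c u : ℂ} (hu : u = Complex.exp c) :
    AnalyticAt ℂ (logBranch c) u := by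
  subst hu
  refine analyticAt_const.add (AnalyticAt.clog (analyticAt_id.div analyticAt_const
    (Complex.exp_ne_zero c)) ?_)
  simp [Complex.exp_ne_zero]

/-- Continuation of a function with a logarithmic singularity. -/
theorem continuesTo_logBranch {n : ℕ} {a x : Fin n → ℂ} (q : Path a x)
    {y A B : (Fin n → ℂ) → ℂ} (hy : ∀ t, AnalyticAt ℂ y (q t)) (hA : ∀ t, AnalyticAt ℂ A (q t))
    (hB : ∀ t, AnalyticAt ℂ B (q t)) {l : unitInterval → ℂ} (hl : Continuous l)
    (hexp : ∀ t, Complex.exp (l t) = y (q t)) :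
    ContinuesTo q (fun x => A x * logBranch (l 0) (y x) + B x)
      (fun x => A x * logBranch (l 1) (y x) + B x) := by
  refine ⟨fun t x => A x * logBranch (l t) (y x) + B x, fun t => ?_, fun t => ?_,
    EventuallyEq.rfl, EventuallyEq.rfl⟩
  · exact ((hA t).mul ((analyticAt_logBranch (hexp t).symm).comp (hy t))).add (hB t)
  · have h1 : ∀ᶠ s in 𝓝 t, ‖l s - l t‖ < 1 := by
      have : ContinuousAt (fun s => ‖l s - l t‖) t := by fun_prop
      exact this.eventually_lt_const (by simp)
    filter_upwards [h1] with s hs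
    have h2 := (hy s).continuousAt.eventually
      (by rw [← hexp s]; exact eventually_norm_log_div_exp_lt (l s))
    filter_upwards [h2] with x hx
    have h3 := (Complex.abs_im_le_norm (l s - l t)).trans hs.le
    have := Real.pi_gt_three
    rw [logBranch_eq (c := l s) (c' := l t) hx.1 hx.2 (by linarith)]

/-! ### The logarithmic singularity and nontrivial monodromy. -/

/-- The regular part of `depthLog (r + 1)` at `x_r ⋯ x_{n-1} = 1`. -/
noncomputable def regularPart {n : ℕ} (r : ℕ) (x : Fin n → ℂ) : ℂ :=
  -(tailProd r x * topMean (iterDiff (coords x) (tailProd r x • fstVar) r 1))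

/-- The coefficient of `-log (1 - x_r ⋯ x_{n-1})` in `depthLog (r + 1)`: the multiple logarithm of
`x_0, …, x_{r-1}`. -/
noncomputable def logCoeff {n : ℕ} (r : ℕ) (x : Fin n → ℂ) : ℂ :=
  iter (coords x) r 1 (1, 1)

theorem analyticAt_logCoeff {n r : ℕ} {x : Fin n → ℂ} (h : Admissible (coords x) r 1) :
    AnalyticAt ℂ (logCoeff r) x :=
  analyticAt_eval (analyticAt_iter r (fun i _ => analyticAt_coords i x)
    (R := fun _ => 1) analyticAt_const h) _

theorem admissible_smul_fstVar {n r : ℕ} (hr : r ≤ n) {x : Fin n → ℂ}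
    (h : TailAdmissible r x) : Admissible (coords x) r (tailProd r x • fstVar) :=
  (h.admissible hr).smul (ω := id) fun _ => rfl

/-- Only indices `i < r` are constrained: the ray to `x_r ⋯ x_{n-1}` itself may pass through `1`. -/
theorem analyticAt_regularPart {n r : ℕ} (hr : r ≤ n) {x : Fin n → ℂ}
    (h : Admissible (coords x) r 1) (h' : TailAdmissible r x) :
    AnalyticAt ℂ (regularPart r) x := by
  refine ((analyticAt_tailProd r x).mul ((topMean.analyticAt _).comp
    (analyticAt_iterDiff r (fun i _ => analyticAt_coords i x)
      (W := fun x => tailProd r x • fstVar) (R := fun _ => 1)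
      ((analyticAt_tailProd r x).smul analyticAt_const) analyticAt_const h ?_))).neg
  rw [mul_one]
  exact admissible_smul_fstVar hr h'

theorem integral_div_one_sub {y : ℂ} (hy : ‖y‖ < 1) :
    ∫ v : unitInterval, y / (1 - ((v : ℝ) : ℂ) * y) = -Complex.log (1 - y) := by
  have hre : ∀ v ∈ Set.uIcc (0 : ℝ) 1, 0 < (1 - (v : ℂ) * y).re := by
    intro v hv
    rw [Set.uIcc_of_le zero_le_one] at hv
    have h1 : ((v : ℂ) * y).re ≤ ‖(v : ℂ) * y‖ := Complex.re_le_norm _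
    rw [norm_mul, Complex.norm_real, Real.norm_of_nonneg hv.1] at h1
    have h2 := mul_le_of_le_one_left (norm_nonneg y) hv.2
    rw [Complex.sub_re, Complex.one_re]
    linarith
  have hd : ∀ v ∈ Set.uIcc (0 : ℝ) 1,
      HasDerivAt (fun v : ℝ => -Complex.log (1 - (v : ℂ) * y)) (y / (1 - (v : ℂ) * y)) v := by
    intro v hv
    have h1 : HasDerivAt (fun v : ℝ => 1 - (v : ℂ) * y) (-y) v := by
      simpa using ((Complex.ofRealCLM.hasDerivAt (x := v)).mul_const y).const_sub 1
    exact (h1.clog_real (Or.inl (hre v hv))).neg.congr_deriv (by rw [neg_div, neg_neg])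
  have hc : ContinuousOn (fun v : ℝ => y / (1 - (v : ℂ) * y)) (Set.uIcc 0 1) := by
    refine ContinuousOn.div (by fun_prop) (by fun_prop) fun v hv h0 => ?_
    have := hre v hv
    rw [h0] at this
    simp at this
  rw [integral_unitInterval fun v : ℝ => y / (1 - (v : ℂ) * y),
    intervalIntegral.integral_eq_sub_of_hasDerivAt hd hc.intervalIntegrable]
  simp

/-- The logarithmic singularity of `depthLog (r + 1)` at `x_r ⋯ x_{n-1} = 1`. -/
theorem depthLog_succ_eq {n r : ℕ} (hr : r < n) {x : Fin n → ℂ} (hx : ∀ k, ‖x k‖ < 1) :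
    depthLog (r + 1) x = -logCoeff r x * Complex.log (1 - tailProd r x) + regularPart r x := by
  set y := tailProd r x with hy
  have hyn : ‖y‖ < 1 := norm_prod_coords_lt_one hx hr le_rfl
  have hadm : Admissible (coords x) r 1 := fun i hi z => by
    simpa using mul_ne_one_of_norm_lt_one (norm_prod_coords_lt_one hx hi hr.le) z.2
  have htail := tailAdmissible_of_norm_lt_one hr.le hx
  have e : coords x r * tailProd (r + 1) x = y := (Finset.prod_eq_prod_Ico_succ_bot hr _).symm
  have hu := ((tailAdmissible_of_norm_lt_one (j := r + 1) hr hx).admissible hr).isUnit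
  rw [smul_smul, e] at hu
  have hne : ∀ v : unitInterval, 1 - ((v : ℝ) : ℂ) * y ≠ 0 := fun v =>
    sub_ne_zero.2 (mul_ne_one_of_norm_lt_one hyn v).symm
  -- The factor `v y - 1` will cancel the denominator `1 - v y`, leaving the pole only on the
  -- constant term `logCoeff r x`. The square's first coordinate plays the role of `v`.
  have h1 : ∀ v : unitInterval, iter (coords x) r (y • 1) (1, v) =
      logCoeff r x + (((v : ℝ) : ℂ) * y - 1) * iterDiff (coords x) (y • fstVar) r 1 (v, 1) := by
    intro v
    have h2 := iter_smul_apply (coords x) r y (htail.admissible hr.le) (w := fstVar) (ω := id)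
      (fun _ => rfl) v 1 1
    have h3 := iter_smul_apply (coords x) r 1 (by rwa [one_smul]) (w := 1) (ω := fun _ => 1)
      (fun _ => by simp) v 1 1
    have h4 := DFunLike.congr_fun (iter_sub_iter (w := y • fstVar) (fun u t t' => rfl) r hadm
      (by rw [mul_one]; exact admissible_smul_fstVar hr.le htail)) (v, 1)
    simp only [one_smul, mul_one, id] at h2 h3
    rw [mul_one, ContinuousMap.sub_apply, h2, h3] at h4
    rw [logCoeff, eq_add_of_sub_eq h4]
    simp only [ContinuousMap.mul_apply, ContinuousMap.sub_apply, ContinuousMap.smul_apply,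
      ContinuousMap.one_apply, fstVar_apply, smul_eq_mul]
    ring
  have h5 : depthLog (r + 1) x = ∫ v : unitInterval,
      (logCoeff r x * (y / (1 - ((v : ℝ) : ℂ) * y))
        - y * iterDiff (coords x) (y • fstVar) r 1 (v, 1)) := by
    simp only [depthLog, iter, smul_smul, e, ContinuousMap.mul_apply, rayMean_apply, sndVar_apply,
      inverse_apply hu, one_mul, h1]
    simp only [Set.Icc.coe_one, Complex.ofReal_one, one_mul]
    congr 1
    ext v
    simp only [ContinuousMap.mul_apply, ContinuousMap.sub_apply, ContinuousMap.smul_apply,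
      ContinuousMap.one_apply, sndVar_apply, smul_eq_mul, mul_one]
    have := hne v
    field_simp
    ring
  rw [h5, MeasureTheory.integral_sub, MeasureTheory.integral_const_mul, integral_div_one_sub hyn,
    MeasureTheory.integral_const_mul, regularPart, topMean_apply]
  · ring
  · exact (integrable_of_continuous (Continuous.div (by fun_prop) (by fun_prop) hne)).const_mul _
  · exact integrable_of_continuous (by fun_prop)

theorem isPreconnected_polydisc (n : ℕ) : IsPreconnected {x : Fin n → ℂ | ∀ k, ‖x k‖ < 1} := by
  have e : {x : Fin n → ℂ | ∀ k, ‖x k‖ < 1} = Set.univ.pi fun _ => Metric.ball (0 : ℂ) 1 := by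
    ext x
    simp
  rw [e]
  exact isPreconnected_univ_pi fun _ => (convex_ball _ _).isPreconnected

/-- By the identity theorem on the polydisc it suffices to look at `(1/2, …, 1/2)`, where the weight
is nonzero and the series has positive terms. -/
theorem not_eventually_weight_mul_logCoeff_eq_zero {n r : ℕ} (hr : r < n) {b : Fin n → ℂ}
    (hb : ∀ k, ‖b k‖ < 1) :
    ¬ (fun x => weight (r + 1) x * logCoeff r x) =ᶠ[𝓝 b] fun _ => 0 := by
  intro h
  have han : AnalyticOnNhd ℂ (fun x : Fin n → ℂ => weight (r + 1) x * logCoeff r x)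
      {x | ∀ k, ‖x k‖ < 1} := fun x hx => (analyticAt_weight _ x).mul
    (analyticAt_logCoeff fun i hi z => by
      simpa using mul_ne_one_of_norm_lt_one (norm_prod_coords_lt_one hx hi hr.le) z.2)
  have hz := han.eqOn_of_preconnected_of_eventuallyEq (fun _ _ => analyticAt_const)
    (isPreconnected_polydisc n) hb h
  have hhalf : ∀ k : Fin n, ‖(fun _ => (((1 / 2 : ℝ)) : ℂ) : Fin n → ℂ) k‖ < 1 := fun k => by
    rw [Complex.norm_real]
    norm_num
  have h0 := hz hhalf
  have hcoords : ∀ i, coords (fun _ => (((1 / 2 : ℝ)) : ℂ) : Fin n → ℂ) i ≠ 0 := by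
    intro i
    unfold coords
    split_ifs <;> norm_num
  have hw : weight (r + 1) (fun _ => (((1 / 2 : ℝ)) : ℂ) : Fin n → ℂ) ≠ 0 :=
    Finset.prod_ne_zero_iff.2 fun i _ => Finset.prod_ne_zero_iff.2 fun k _ => hcoords k
  have hres : logCoeff r (fun _ => (((1 / 2 : ℝ)) : ℂ) : Fin n → ℂ) ≠ 0 := by
    rw [logCoeff, iter_congr (x' := fun _ => (((1 / 2 : ℝ)) : ℂ)) fun i hi => by
      simp [coords, hi.trans hr]]
    exact iter_ne_zero_of_pos (by norm_num) (by norm_num)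
  exact mul_ne_zero hw hres h0

/-- A loop around `x_s ⋯ x_n = 1` with nonzero winding number acts nontrivially. -/
theorem IsLoopAround.not_trivialMonodromy {n : ℕ} {b : Fin n → ℂ} (hb : ∀ k, ‖b k‖ < 1)
    {s l : Fin n} (hl : (l : ℕ) + 1 = n) {m : ℤ} (hm : m ≠ 0) {q : Path b b}
    (hq : IsLoopAround q s l m) : ¬ TrivialMonodromy q := by
  intro hT
  have hfb : AnalyticAt ℂ (multiLog n) b :=
    (analyticAt_depthLog le_rfl (tailAdmissible_of_norm_lt_one le_rfl hb)).congr
      (multiLog_eventuallyEq hb).symm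
  have hW := continuesTo_weight_mul hb (hT.continuesTo hfb) (j := (s : ℕ) + 1) s.2
  obtain ⟨ℓ, hℓ, hexp, hwind⟩ := hq.winds
  have hsl : (s : ℕ) ≤ l := by omega
  have hadm : ∀ t, Admissible (coords (q t)) s 1 := by
    intro t i hi z
    have hne : ((⟨i, hi.trans s.2⟩, ⟨s - 1, by omega⟩) : Fin n × Fin n) ≠ (s, l) := by
      intro h
      have := congrArg (fun p : Fin n × Fin n => (p.1 : ℕ)) h
      simp only at this
      omega
    have hle : (⟨i, hi.trans s.2⟩ : Fin n) ≤ ⟨s - 1, by omega⟩ := Fin.le_def.2 (by simp only; omega)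
    have := mul_consecProd_ne_one hle (hq.not_encloses _ _ hle hne) t z.2
    rw [consecProd_eq] at this
    simp only [Nat.sub_add_cancel (show 1 ≤ (s : ℕ) by omega)] at this
    simpa using this
  have htail : ∀ t, TailAdmissible s (q t) := by
    intro t i hi z
    have hne : ((⟨i, hi.trans s.2⟩, l) : Fin n × Fin n) ≠ (s, l) := by
      intro h
      have := congrArg (fun p : Fin n × Fin n => (p.1 : ℕ)) h
      simp only at this
      omega
    have hle : (⟨i, hi.trans s.2⟩ : Fin n) ≤ l := Fin.le_def.2 (by simp only; omega)
    have := mul_consecProd_ne_one hle (hq.not_encloses _ _ hle hne) t z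
    rwa [← tailProd_eq_consecProd hl] at this
  -- Shift `ℓ` by the constant `c - ℓ 0` so that it starts at the principal logarithm at `b`.
  set c := Complex.log (1 - tailProd s b) with hc
  have hbs : ‖tailProd (s : ℕ) b‖ < 1 := norm_prod_coords_lt_one hb s.2 le_rfl
  have hre : ∀ y : ℂ, ‖y‖ < 1 → 0 < (1 - y).re := fun y hy => by
    have := Complex.re_le_norm y
    rw [Complex.sub_re, Complex.one_re]
    linarith
  have hb0 : 1 - tailProd (s : ℕ) b ≠ 0 := fun h => by
    have := hre _ hbs
    rw [h] at this
    simp at this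
  have hec : Complex.exp c = 1 - tailProd s b := Complex.exp_log hb0
  have hexp' : ∀ t, Complex.exp (ℓ t + (c - ℓ 0)) = 1 - tailProd s (q t) := by
    intro t
    have h0 : Complex.exp (ℓ 0) = 1 - tailProd s b := by
      rw [hexp 0, q.source, tailProd_eq_consecProd hl]
    rw [Complex.exp_add, Complex.exp_sub, h0, hec, div_self hb0, mul_one, hexp t,
      tailProd_eq_consecProd hl]
  have hL := continuesTo_logBranch q (y := fun x => 1 - tailProd s x)
    (A := fun x => -(weight (s + 1) x * logCoeff s x))
    (B := fun x => weight (s + 1) x * regularPart s x)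
    (fun t => analyticAt_const.sub (analyticAt_tailProd _ _))
    (fun t => ((analyticAt_weight _ _).mul (analyticAt_logCoeff (hadm t))).neg)
    (fun t => (analyticAt_weight _ _).mul (analyticAt_regularPart s.2.le (hadm t) (htail t)))
    (l := fun t => ℓ t + (c - ℓ 0)) (by fun_prop) hexp'
  have hstart : (fun x => -(weight (s + 1) x * logCoeff s x) *
        logBranch (ℓ 0 + (c - ℓ 0)) (1 - tailProd s x) + weight (s + 1) x * regularPart s x)
      =ᶠ[𝓝 b] fun x => weight ((s : ℕ) + 1) x * depthLog ((s : ℕ) + 1) x := by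
    have hcont : ContinuousAt (fun x : Fin n → ℂ => 1 - tailProd (s : ℕ) x) b :=
      (analyticAt_const.sub (analyticAt_tailProd _ _)).continuousAt
    have hev := hcont.eventually (by
      show ∀ᶠ u in 𝓝 (1 - tailProd (s : ℕ) b), _
      rw [← hec]
      exact eventually_norm_log_div_exp_lt c)
    filter_upwards [hev, (isOpen_polydisc n).mem_nhds hb] with x hx hxp
    have hlog : logBranch c (1 - tailProd s x) = Complex.log (1 - tailProd s x) := by
      -- The principal logarithm is the branch centred at `0`; it matches because `1 - tailProd s b`
      -- has positive real part, so `|Im c| ≤ π / 2`.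
      rw [← logBranch_eq (c := c) (c' := 0) hx.1 hx.2]
      · simp [logBranch]
      · rw [sub_zero, hc, Complex.log_im]
        exact Complex.abs_arg_le_pi_div_two_iff.2 (hre _ hbs).le
    rw [add_sub_cancel, hlog, depthLog_succ_eq s.2 hxp]
    ring
  have hend := (hL.unique hW hstart).trans hstart.symm
  refine not_eventually_weight_mul_logCoeff_eq_zero s.2 hb ?_
  filter_upwards [hend] with x hx
  -- With equal exponentials at both ends, the initial and final branches differ by the constant `ℓ
  -- 1 - ℓ 0 = 2πi m`.
  have hper : Complex.exp (ℓ 1 + (c - ℓ 0)) = Complex.exp (ℓ 0 + (c - ℓ 0)) := by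
    rw [hexp' 1, hexp' 0, q.source, q.target]
  simp only [logBranch, hper] at hx
  have h2 : weight ((s : ℕ) + 1) x * logCoeff s x * (2 * (Real.pi : ℂ) * Complex.I * (m : ℂ)) = 0 := by
    rw [← hwind]
    linear_combination -hx
  have h3 : (2 * (Real.pi : ℂ) * Complex.I * (m : ℂ)) ≠ 0 :=
    mul_ne_zero Complex.two_pi_I_ne_zero (Int.cast_ne_zero.2 hm)
  exact (mul_eq_zero.1 h2).resolve_right h3

end MultiLog

theorem mainTheorem4 (n : ℕ) (b : Fin n → ℂ) (hb : ∀ k, ‖b k‖ < 1) :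
    -- trivial monodromy around `{x_i = 1}`, `i < n`
    (∀ i : Fin n, (i : ℕ) + 1 < n → ∀ (m : ℤ) (q : Path b b),
      MultiLog.IsLoopAround q i i m → MultiLog.TrivialMonodromy q) ∧
    -- trivial monodromy around `{x_i ⋯ x_j = 1}`, `i < j < n`
    (∀ i j : Fin n, i < j → (j : ℕ) + 1 < n → ∀ (m : ℤ) (q : Path b b),
      MultiLog.IsLoopAround q i j m → MultiLog.TrivialMonodromy q) ∧
    -- nontrivial monodromy can only come from the components `{x_s ⋯ x_n = 1}`
    (∀ q : Path b b, (∀ t, q t ∈ MultiLog.regularLocus n) → ¬ MultiLog.TrivialMonodromy q →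
      ∃ s l : Fin n, (l : ℕ) + 1 = n ∧ MultiLog.Encloses q s l) ∧
    -- and the monodromy around each of these components is nontrivial
    (∀ s l : Fin n, (l : ℕ) + 1 = n → ∀ (m : ℤ), m ≠ 0 → ∀ q : Path b b,
      MultiLog.IsLoopAround q s l m → ¬ MultiLog.TrivialMonodromy q) := by
  -- When `j` is not the last index, every `D_{sn}` is a component other than `D_{ij}`, hence not
  -- enclosed; this covers `i = j` and `i < j` together.
  have noLast : ∀ (i j : Fin n), (j : ℕ) + 1 < n → ∀ (m : ℤ) (q : Path b b),
      MultiLog.IsLoopAround q i j m → MultiLog.TrivialMonodromy q := fun i j hj m q hq =>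
    MultiLog.trivialMonodromy_of_not_encloses hb fun s l hl =>
      hq.not_encloses s l (Fin.le_def.2 (by omega)) fun h => by
        have := congrArg (fun p : Fin n × Fin n => (p.2 : ℕ)) h
        simp only at this
        omega
  refine ⟨fun i hi => noLast i i hi, fun i j _ hj => noLast i j hj, fun q _ hT => ?_,
    fun s l hl m hm q hq => hq.not_trivialMonodromy hb hl hm⟩
  by_contra hne
  push Not at hne
  exact hT (MultiLog.trivialMonodromy_of_not_encloses hb hne)
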